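/- Let $k$ be an algebraically closed field of characteristic $p$, and let $H$ and $H'$ be finite-dimensional semisimple Hopf algebras over $k$ with $p>\dim_k(H)^{1/2}$. For a nonzero (left) integral $\Lambda$ of $H$ (i.e. $h\Lambda=\varepsilon(h)\Lambda$ for all $h\in H$) put $\mathbf u=S(\Lambda_{(2)})\Lambda_{(1)}$, where $S$ is the antipode. The Sweedler powers $P_n:H\to H$, $n\in\mathbb Z$, are $P_n(a)=a_{(1)}\cdots a_{(n)}$ for $n\ge 1$, $P_0(a)=\varepsilon(a)1$, and $P_n(a)=S(a_{(1)})\cdots S(a_{(-n)})$ for $n\le -1$. For a finite-dimensional representation $V$ of $H$ with character $\chi_V$, the $n$-th Frobenius--Schur indicator of $V$ is $$\nu_n(V)=\chi_V\bigl(\mathbf u^{-1}P_n(\Lambda)\bigr),\qquad n\in\mathbb Z,$$ and similarly for $H'$. Let $\mathcal F:\mathrm{Rep}(H)\to\mathrm{Rep}(H')$ be an equivalence of tensor categories, that is, a $k$-linear monoidal functor that is an equivalence between the categories of finite-dimensional representations. Then the indicators are well defined (both $H$ and $H'$ have nonzero integrals, and for every nonzero integral the element $\mathbf u$ is invertible),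 and, whichever nonzero integrals of $H$ and $H'$ are used to compute them, $$\nu_n(V)=\nu_n(\mathcal F(V))$$ for every $n\in\mathbb Z$ and every finite-dimensional representation $V$ of $H$. So the higher Frobenius--Schur indicators are gauge invariants. -/

import Mathlib

open CategoryTheory
open scoped TensorProduct

universe u

/-- A finite-dimensional representation of the `k`-algebra `H`: a finite-dimensional `k`-vector
space together with an algebra homomorphism `ρ : H → End_k(V)`. -/
structure FinRep (k : Type u) (H : Type u) [Field k] [Ring H] [Algebra k H] where
  /-- the underlying vector space -/
  carrier : Type u
  [addCommGroup : AddCommGroup carrier]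
  [module : Module k carrier]
  [finite : Module.Finite k carrier]
  /-- the action -/
  ρ : H →ₐ[k] Module.End k carrier

namespace FinRep

attribute [instance] FinRep.addCommGroup FinRep.module FinRep.finite

section Category

variable {k H : Type u} [Field k] [Ring H] [Algebra k H]

instance : CoeSort (FinRep k H) (Type u) := ⟨FinRep.carrier⟩

/-- Morphisms of representations: the `k`-linear maps that commute with the action of `H`. -/
@[ext]
structure Hom (V W : FinRep k H) where
  /-- the underlying linear map -/
  lin : V →ₗ[k] W
  /-- `H`-equivariance -/
  comm : ∀ (h : H) (v : V), lin (V.ρ h v) = W.ρ h (lin v)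

/-- The category `Rep(H)` of finite-dimensional representations of `H`. -/
instance : Category (FinRep k H) where
  Hom V W := Hom V W
  id V := ⟨LinearMap.id, fun _ _ => rfl⟩
  comp f g := ⟨g.lin ∘ₗ f.lin, fun h v => by simp [f.comm, g.comm]⟩

@[ext]
theorem hom_ext {V W : FinRep k H} {f g : V ⟶ W} (h : f.lin = g.lin) : f = g := Hom.ext h

theorem comm_apply {V W : FinRep k H} (f : V ⟶ W) (h : H) (v : V) :
    f.lin (V.ρ h v) = W.ρ h (f.lin v) := f.comm h v

@[simp]
theorem id_lin (V : FinRep k H) : (𝟙 V : V ⟶ V).lin = LinearMap.id := rfl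

@[simp]
theorem comp_lin {U V W : FinRep k H} (f : U ⟶ V) (g : V ⟶ W) :
    (f ≫ g).lin = g.lin ∘ₗ f.lin := rfl

section Linear

variable (V W : FinRep k H)

instance : Zero (V ⟶ W) := ⟨⟨0, by simp⟩⟩
instance : Add (V ⟶ W) := ⟨fun f g => ⟨f.lin + g.lin, by simp [comm_apply]⟩⟩
instance : Neg (V ⟶ W) := ⟨fun f => ⟨-f.lin, by simp [comm_apply]⟩⟩
instance : Sub (V ⟶ W) := ⟨fun f g => ⟨f.lin - g.lin, by simp [comm_apply]⟩⟩
instance : SMul ℕ (V ⟶ W) := ⟨fun n f => ⟨n • f.lin, by simp [comm_apply]⟩⟩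
instance : SMul ℤ (V ⟶ W) := ⟨fun n f => ⟨n • f.lin, by simp [comm_apply]⟩⟩
instance : SMul k (V ⟶ W) := ⟨fun c f => ⟨c • f.lin, by simp [comm_apply]⟩⟩

theorem lin_injective :
    Function.Injective (fun f : V ⟶ W => f.lin) := fun _ _ h => hom_ext h

instance : AddCommGroup (V ⟶ W) :=
  (lin_injective V W).addCommGroup _ rfl (fun _ _ => rfl) (fun _ => rfl) (fun _ _ => rfl)
    (fun _ _ => rfl) (fun _ _ => rfl)

instance instModuleHom : Module k (V ⟶ W) :=
  (lin_injective V W).module k ⟨⟨fun f => f.lin, rfl⟩, fun _ _ => rfl⟩ (fun _ _ => rfl)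

end Linear

@[simp]
theorem add_lin {V W : FinRep k H} (f g : V ⟶ W) : (f + g).lin = f.lin + g.lin := rfl

@[simp]
theorem smul_lin {V W : FinRep k H} (c : k) (f : V ⟶ W) : (c • f).lin = c • f.lin := rfl

instance : Preadditive (FinRep k H) where
  add_comp _ _ _ f f' g := hom_ext (LinearMap.comp_add f.lin f'.lin g.lin)
  comp_add _ _ _ f g g' := hom_ext (LinearMap.add_comp f.lin g'.lin g.lin)

instance : CategoryTheory.Linear k (FinRep k H) where
  homModule V W := instModuleHom V W
  smul_comp _ _ _ c f g := hom_ext (LinearMap.comp_smul g.lin c f.lin)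
  comp_smul _ _ _ f c g := hom_ext (LinearMap.smul_comp c g.lin f.lin)

/-- The character `χ_V(h) = tr(ρ_V(h))`. -/
noncomputable def character (V : FinRep k H) (h : H) : k :=
  LinearMap.trace k V (V.ρ h)

/-- The forgetful functor to `k`-vector spaces. -/
def forgetToModuleCat (k H : Type u) [Field k] [Ring H] [Algebra k H] :
    FinRep k H ⥤ ModuleCat.{u} k where
  obj V := ModuleCat.of k V
  map f := ModuleCat.ofHom f.lin

instance : (forgetToModuleCat k H).Faithful where
  map_injective h := hom_ext (congrArg ModuleCat.Hom.hom h)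

/-- An equivariant linear isomorphism is an isomorphism of representations. -/
def mkIso {V W : FinRep k H} (e : V ≃ₗ[k] W) (he : ∀ (h : H) (v : V), e (V.ρ h v) = W.ρ h (e v)) :
    V ≅ W where
  hom := ⟨e.toLinearMap, he⟩
  inv := ⟨e.symm.toLinearMap, fun h w => e.injective (by simp [he])⟩
  hom_inv_id := hom_ext (by ext; simp)
  inv_hom_id := hom_ext (by ext; simp)

end Category

section Action

variable {k H M N P : Type*} [Field k] [Ring H] [Bialgebra k H]
  [AddCommGroup M] [Module k M] [AddCommGroup N] [Module k N] [AddCommGroup P] [Module k P]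

/-- The action of `H` on a tensor product, through `Δ`:
`h (v ⊗ w) = h₍₁₎ v ⊗ h₍₂₎ w`. -/
noncomputable def tensorAction (ρ : H →ₐ[k] Module.End k M) (σ : H →ₐ[k] Module.End k N) :
    H →ₐ[k] Module.End k (M ⊗[k] N) :=
  (Module.endTensorEndAlgHom (R := k) (S := k) (A := k) (M := M) (N := N)).comp
    ((Algebra.TensorProduct.map ρ σ).comp (Bialgebra.comulAlgHom k H))

/-- The action of `H` on `k` through the counit: `h c = ε(h) c`. -/
noncomputable def trivialAction (k H : Type*) [Field k] [Ring H] [Bialgebra k H] :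
    H →ₐ[k] Module.End k k :=
  (Algebra.ofId k (Module.End k k)).comp (Bialgebra.counitAlgHom k H)

/-- The orbit map `H → M`, `h ↦ h v`. -/
def orbit (ρ : H →ₐ[k] Module.End k M) (v : M) : H →ₗ[k] M :=
  (LinearMap.applyₗ v : Module.End k M →ₗ[k] M) ∘ₗ ρ.toLinearMap

@[simp]
theorem orbit_apply (ρ : H →ₐ[k] Module.End k M) (v : M) (h : H) : orbit ρ v h = ρ h v := rfl

theorem tensorAction_tmul (ρ : H →ₐ[k] Module.End k M) (σ : H →ₐ[k] Module.End k N)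
    (h : H) (v : M) (w : N) :
    tensorAction ρ σ h (v ⊗ₜ[k] w) =
      TensorProduct.map (orbit ρ v) (orbit σ w) (Coalgebra.comul (R := k) h) := by
  change Module.endTensorEndAlgHom (R := k) (S := k) (A := k) (M := M) (N := N)
    (Algebra.TensorProduct.map ρ σ (Coalgebra.comul (R := k) h)) (v ⊗ₜ[k] w) = _
  induction Coalgebra.comul (R := k) h using TensorProduct.induction_on with
  | zero => simp
  | tmul a b => rfl
  | add x y hx hy => simp only [map_add, LinearMap.add_apply, hx, hy]

theorem tensorAction_orbit (ρ : H →ₐ[k] Module.End k M) (σ : H →ₐ[k] Module.End k N)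
    (v : M) (w : N) :
    orbit (tensorAction ρ σ) (v ⊗ₜ[k] w) =
      TensorProduct.map (orbit ρ v) (orbit σ w) ∘ₗ Coalgebra.comul :=
  LinearMap.ext fun h => tensorAction_tmul ρ σ h v w

@[simp]
theorem trivialAction_apply (h : H) (c : k) :
    trivialAction k H h c = Coalgebra.counit (R := k) h * c := rfl

theorem map_tensorAction {M' N' : Type*} [AddCommGroup M'] [Module k M'] [AddCommGroup N']
    [Module k N'] (ρ : H →ₐ[k] Module.End k M) (σ : H →ₐ[k] Module.End k N)
    (ρ' : H →ₐ[k] Module.End k M') (σ' : H →ₐ[k] Module.End k N')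
    (f : M →ₗ[k] M') (g : N →ₗ[k] N') (hf : ∀ (h : H) (v : M), f (ρ h v) = ρ' h (f v))
    (hg : ∀ (h : H) (w : N), g (σ h w) = σ' h (g w)) (h : H) :
    TensorProduct.map f g ∘ₗ tensorAction ρ σ h = tensorAction ρ' σ' h ∘ₗ TensorProduct.map f g := by
  refine TensorProduct.ext' fun v w => ?_
  have hf' : f ∘ₗ orbit ρ v = orbit ρ' (f v) := LinearMap.ext fun a => hf a v
  have hg' : g ∘ₗ orbit σ w = orbit σ' (g w) := LinearMap.ext fun a => hg a w
  rw [LinearMap.comp_apply, LinearMap.comp_apply, TensorProduct.map_tmul, tensorAction_tmul,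
    tensorAction_tmul, ← hf', ← hg', TensorProduct.map_comp, LinearMap.comp_apply]

theorem assoc_tensorAction (ρ : H →ₐ[k] Module.End k M) (σ : H →ₐ[k] Module.End k N)
    (τ : H →ₐ[k] Module.End k P) (h : H) :
    (TensorProduct.assoc k M N P).toLinearMap ∘ₗ tensorAction (tensorAction ρ σ) τ h =
      tensorAction ρ (tensorAction σ τ) h ∘ₗ (TensorProduct.assoc k M N P).toLinearMap := by
  refine TensorProduct.ext_threefold fun u v w => ?_
  have h1 : TensorProduct.map (TensorProduct.map (orbit ρ u) (orbit σ v) ∘ₗ Coalgebra.comul)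
      (orbit τ w) = TensorProduct.map (TensorProduct.map (orbit ρ u) (orbit σ v)) (orbit τ w) ∘ₗ
        (Coalgebra.comul (R := k) (A := H)).rTensor H :=
    TensorProduct.ext' fun a b => rfl
  have h2 : TensorProduct.map (orbit ρ u)
      (TensorProduct.map (orbit σ v) (orbit τ w) ∘ₗ Coalgebra.comul) =
        TensorProduct.map (orbit ρ u) (TensorProduct.map (orbit σ v) (orbit τ w)) ∘ₗ
        (Coalgebra.comul (R := k) (A := H)).lTensor H :=
    TensorProduct.ext' fun a b => rfl
  have h3 : (TensorProduct.assoc k M N P).toLinearMap ∘ₗ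
      TensorProduct.map (TensorProduct.map (orbit ρ u) (orbit σ v)) (orbit τ w) =
      TensorProduct.map (orbit ρ u) (TensorProduct.map (orbit σ v) (orbit τ w)) ∘ₗ
        (TensorProduct.assoc k H H H).toLinearMap :=
    TensorProduct.ext_threefold fun a b c => rfl
  simp only [LinearMap.comp_apply, LinearEquiv.coe_coe, TensorProduct.assoc_tmul,
    tensorAction_tmul, tensorAction_orbit, h1, h2]
  rw [← Coalgebra.coassoc_apply]
  exact LinearMap.congr_fun h3 _

theorem lid_tensorAction (ρ : H →ₐ[k] Module.End k M) (h : H) :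
    (TensorProduct.lid k M).toLinearMap ∘ₗ tensorAction (trivialAction k H) ρ h =
      ρ h ∘ₗ (TensorProduct.lid k M).toLinearMap := by
  refine TensorProduct.ext' fun c v => ?_
  have h1 : (TensorProduct.lid k M).toLinearMap ∘ₗ
      TensorProduct.map (orbit (trivialAction k H) c) (orbit ρ v) =
      c • orbit ρ v ∘ₗ (TensorProduct.lid k H).toLinearMap ∘ₗ
        (Coalgebra.counit (R := k) (A := H)).rTensor H :=
    TensorProduct.ext' fun a b => by simp [smul_smul, mul_comm]
  have h2 := LinearMap.congr_fun h1 (Coalgebra.comul h)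
  simp only [LinearMap.comp_apply, LinearMap.smul_apply, Coalgebra.rTensor_counit_comul] at h2
  simp only [LinearMap.comp_apply, tensorAction_tmul, h2]
  simp

theorem rid_tensorAction (ρ : H →ₐ[k] Module.End k M) (h : H) :
    (TensorProduct.rid k M).toLinearMap ∘ₗ tensorAction ρ (trivialAction k H) h =
      ρ h ∘ₗ (TensorProduct.rid k M).toLinearMap := by
  refine TensorProduct.ext' fun v c => ?_
  have h1 : (TensorProduct.rid k M).toLinearMap ∘ₗ
      TensorProduct.map (orbit ρ v) (orbit (trivialAction k H) c) =
      c • orbit ρ v ∘ₗ (TensorProduct.rid k H).toLinearMap ∘ₗ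
        (Coalgebra.counit (R := k) (A := H)).lTensor H :=
    TensorProduct.ext' fun a b => by simp [smul_smul, mul_comm]
  have h2 := LinearMap.congr_fun h1 (Coalgebra.comul h)
  simp only [LinearMap.comp_apply, LinearMap.smul_apply, Coalgebra.lTensor_counit_comul] at h2
  simp only [LinearMap.comp_apply, tensorAction_tmul, h2]
  simp

end Action

section Monoidal

variable {k H : Type u} [Field k] [Ring H] [Bialgebra k H]

/-- The tensor product of two representations. -/
noncomputable def tensor (V W : FinRep k H) : FinRep k H where
  carrier := V ⊗[k] W
  ρ := tensorAction V.ρ W.ρ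

/-- The trivial representation `k`. -/
noncomputable def trivial (k H : Type u) [Field k] [Ring H] [Bialgebra k H] : FinRep k H where
  carrier := k
  ρ := trivialAction k H

/-- The tensor product of two morphisms. -/
noncomputable def tensorMap {V V' W W' : FinRep k H} (f : V ⟶ V') (g : W ⟶ W') :
    tensor V W ⟶ tensor V' W' where
  lin := TensorProduct.map f.lin g.lin
  comm h x := LinearMap.congr_fun (map_tensorAction V.ρ W.ρ V'.ρ W'.ρ f.lin g.lin f.comm g.comm h) x

noncomputable instance : MonoidalCategoryStruct (FinRep k H) where
  tensorObj := tensor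
  tensorUnit := trivial k H
  tensorHom f g := tensorMap f g
  whiskerLeft V _ _ g := tensorMap (𝟙 V) g
  whiskerRight f W := tensorMap f (𝟙 W)
  associator U V W := mkIso (V := tensor (tensor U V) W) (W := tensor U (tensor V W))
    (TensorProduct.assoc k U V W) fun h x => LinearMap.congr_fun (assoc_tensorAction U.ρ V.ρ W.ρ h) x
  leftUnitor V := mkIso (V := tensor (trivial k H) V) (W := V)
    (TensorProduct.lid k V) fun h x => LinearMap.congr_fun (lid_tensorAction V.ρ h) x
  rightUnitor V := mkIso (V := tensor V (trivial k H)) (W := V)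
    (TensorProduct.rid k V) fun h x => LinearMap.congr_fun (rid_tensorAction V.ρ h) x

/-- The tensor product, unit, associator and unitors of `Rep(H)` are those of vector spaces. -/
noncomputable def inducingData (k H : Type u) [Field k] [Ring H] [Bialgebra k H] :
    Monoidal.InducingFunctorData (forgetToModuleCat k H) where
  μIso _ _ := Iso.refl _
  εIso := Iso.refl _
  whiskerLeft_eq _ _ _ _ := rfl
  whiskerRight_eq _ _ := rfl
  tensorHom_eq _ _ := rfl
  associator_eq U V W := by
    refine ModuleCat.hom_ext (TensorProduct.ext_threefold fun _ _ _ => rfl)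
  leftUnitor_eq V := by
    refine ModuleCat.hom_ext (TensorProduct.ext' fun _ _ => rfl)
  rightUnitor_eq V := by
    refine ModuleCat.hom_ext (TensorProduct.ext' fun _ _ => rfl)

/-- The tensor category `Rep(H)`. -/
noncomputable instance : MonoidalCategory (FinRep k H) :=
  Monoidal.induced (forgetToModuleCat k H) (inducingData k H)

end Monoidal

end FinRep

namespace HopfFS

section Bialgebra

variable (k : Type u) {H : Type u} [Field k] [Ring H] [Bialgebra k H]

/-- `Λ` is a (left) integral of `H`: `h Λ = ε(h) Λ` for all `h`. -/
def IsLeftIntegral (Λ : H) : Prop :=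
  ∀ h : H, h * Λ = Coalgebra.counit (R := k) h • Λ

/-- The `n`-fold convolution power of a linear map `f : H → H`:
`a ↦ f(a₍₁₎) ⋯ f(a₍ₙ₎)` for `n ≥ 1`, and `a ↦ ε(a) 1` for `n = 0`. -/
noncomputable def convPow (f : H →ₗ[k] H) : ℕ → (H →ₗ[k] H)
  | 0 => Algebra.linearMap k H ∘ₗ Coalgebra.counit
  | n + 1 => LinearMap.mul' k H ∘ₗ TensorProduct.map f (convPow f n) ∘ₗ Coalgebra.comul

end Bialgebra

variable (k : Type u) {H : Type u} [Field k] [Ring H] [HopfAlgebra k H]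

/-- The Sweedler power maps: `P_n(a) = a₍₁₎ ⋯ a₍ₙ₎` for `n ≥ 1`, `P_0(a) = ε(a) 1`, and
`P_n(a) = S(a₍₁₎) ⋯ S(a₍₋ₙ₎)` for `n ≤ -1`. -/
noncomputable def sweedlerPow : ℤ → (H →ₗ[k] H)
  | Int.ofNat n => convPow k LinearMap.id n
  | Int.negSucc n => convPow k (HopfAlgebra.antipode k) (n + 1)

/-- The element `u = S(Λ₍₂₎) Λ₍₁₎`. -/
noncomputable def uElem (Λ : H) : H :=
  LinearMap.mul' k H (TensorProduct.map (HopfAlgebra.antipode k) LinearMap.id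
    (TensorProduct.comm k H H (Coalgebra.comul Λ)))

/-- The `n`-th Frobenius-Schur indicator `ν_n(V) = χ_V(u⁻¹ P_n(Λ))`, computed with the nonzero
integral `Λ`. Here `Ring.inverse` is the inverse of a unit. -/
noncomputable def fsIndicator (Λ : H) (n : ℤ) (V : FinRep k H) : k :=
  V.character (Ring.inverse (uElem k Λ) * sweedlerPow k n Λ)

end HopfFS

/-! The indicator can be written in terms of the tensor category alone, apart from the number dim V,
which tensor equivalences preserve. By additivity of characters it suffices to treat V whose
endomorphisms are scalars (`IsSchur`). Let D be both a left and a right dual of V, with no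
compatibility between the two pairings. The dualities give a linear bijection P of V (`pivotal`),
the identification of V with its double dual read on vectors, with ρ(h)P = Pρ(S²h). Since u h =
S²(h) u (`uElem_mul`), Pρ(u) is equivariant, hence scalar. Comparing traces with χ_V(u) = ε(Λ) dim V
yields ρ(u⁻¹) = tr(P⁻¹) (ε(Λ) dim V)⁻¹ P (`ρ_inverse_uElem`).

The dualities also give a rotation E of Hom(1, V^{⊗n}) for n ≥ 1, which on vectors is P on one
factor followed by a cyclic permutation (`vec_rotation`). The integral acts as ε(Λ) times the
projection onto invariants, and the trace of a cyclic permutation against the action of Λ multiplies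
its Sweedler factors together (`trace_cyc`), so ε(Λ) tr E = tr(Pρ(P_n Λ)). Hence ν_n(V) = tr(P⁻¹)
(dim V)⁻¹ tr E, where tr(P⁻¹) is the loop 1 → V ⊗ D → 1. For n < 0 the inverse rotation for D
replaces E, and for n = 0 the loop tr P does.

A linear monoidal equivalence preserves loops and traces of rotations (`form_tvec_map`,
`trace_rotation_map`), and it preserves dimensions by a growth argument on tensor powers
(`finrank_map`). The bound on p enters through (dim V)² ≤ dim H < p² for scalar-endomorphism V: dim
V is then nonzero in k, which makes u invertible (`isUnit_uElem`) and allows the division above. -/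

namespace HopfFS

/-! ### Rotation of invariants in a monoidal category, and its transport along functors -/

section Categorical

open MonoidalCategory

variable {C : Type*} [Category* C] [MonoidalCategory C]

/-- The tensor power `V ⊗ (V ⊗ ⋯ (V ⊗ 𝟙))`. -/
def tensorPow (V : C) : ℕ → C
  | 0 => 𝟙_ C
  | n + 1 => V ⊗ tensorPow V n

/-- The associativity isomorphism moving the last tensor factor to the front. -/
def cycIso (V : C) : (n : ℕ) → (tensorPow V n ⊗ V ≅ V ⊗ tensorPow V n)
  | 0 => λ_ V ≪≫ (ρ_ V).symm
  | n + 1 => α_ V (tensorPow V n) V ≪≫ whiskerLeftIso V (cycIso V n)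

theorem cycIso_zero_hom (V : C) : (cycIso V 0).hom = (λ_ V).hom ≫ (ρ_ V).inv := rfl

theorem cycIso_succ_hom (V : C) (n : ℕ) : (cycIso V (n + 1)).hom =
    (α_ V (tensorPow V n) V).hom ≫ V ◁ (cycIso V n).hom := rfl

section Mates

variable (V D : C)

/-- This is the adjunction between tensoring with D and with V, evaluated at the unit object. -/
theorem coev_leftMate_bijective [ExactPairing V D] (U : C) :
    Function.Bijective fun g : D ⟶ U => η_ V D ≫ V ◁ g := by
  have h : (fun g : D ⟶ U => η_ V D ≫ V ◁ g) =
      tensorLeftHomEquiv (𝟙_ C) V D U ∘ ((ρ_ D).homFromEquiv (Z := U)).symm := by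
    funext g
    simp only [tensorLeftHomEquiv, Function.comp_apply, Equiv.coe_fn_mk, Iso.homFromEquiv_symm_apply]
    rw [whiskerLeft_comp]
    monoidal
  rw [h]
  exact (Equiv.bijective _).comp (Equiv.bijective _)

theorem coev_rightMate_bijective [ExactPairing D V] (U : C) :
    Function.Bijective fun g : D ⟶ U => η_ D V ≫ g ▷ V := by
  have h : (fun g : D ⟶ U => η_ D V ≫ g ▷ V) =
      tensorRightHomEquiv (𝟙_ C) D V U ∘ ((λ_ D).homFromEquiv (Z := U)).symm := by
    funext g
    simp only [tensorRightHomEquiv, Function.comp_apply, Equiv.coe_fn_mk, Iso.homFromEquiv_symm_apply]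
    rw [comp_whiskerRight]
    monoidal
  rw [h]
  exact (Equiv.bijective _).comp (Equiv.bijective _)

variable (k : Type*) [Field k] [Preadditive C] [Linear k C] [MonoidalPreadditive C]
  [MonoidalLinear k C]

/-- `Hom(D, U) ≃ Hom(𝟙, V ⊗ U)` for a right dual `D` of `V`. -/
noncomputable def leftMate [ExactPairing V D] (U : C) : (D ⟶ U) ≃ₗ[k] (𝟙_ C ⟶ V ⊗ U) :=
  LinearEquiv.ofBijective
    { toFun := fun g => η_ V D ≫ V ◁ g
      map_add' := by simp
      map_smul' := by simp } (coev_leftMate_bijective V D U)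

/-- `Hom(D, U) ≃ Hom(𝟙, U ⊗ V)` for a left dual `D` of `V`. -/
noncomputable def rightMate [ExactPairing D V] (U : C) : (D ⟶ U) ≃ₗ[k] (𝟙_ C ⟶ U ⊗ V) :=
  LinearEquiv.ofBijective
    { toFun := fun g => η_ D V ≫ g ▷ V
      map_add' := by simp
      map_smul' := by simp } (coev_rightMate_bijective V D U)

variable [ExactPairing V D] [ExactPairing D V]

/-- The rotation operator on the invariants of a tensor power of `V`, defined by a two-sided
dual `D` of `V`. -/
noncomputable def rotation (n : ℕ) :
    (𝟙_ C ⟶ V ⊗ tensorPow V n) ≃ₗ[k] (𝟙_ C ⟶ V ⊗ tensorPow V n) :=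
  (leftMate V D k _).symm ≪≫ₗ rightMate V D k _ ≪≫ₗ Linear.homCongr k (Iso.refl _) (cycIso V n)

theorem rotation_apply (n : ℕ) (g : D ⟶ tensorPow V n) :
    rotation V D k n (η_ V D ≫ V ◁ g) = η_ D V ≫ g ▷ V ≫ (cycIso V n).hom := by
  have h : η_ V D ≫ V ◁ g = leftMate V D k _ g := rfl
  have h' : rightMate V D k _ g = η_ D V ≫ g ▷ V := rfl
  simp [rotation, h, h', Linear.homCongr]

end Mates

section Transport

open Functor.LaxMonoidal Functor.OplaxMonoidal

variable {C' : Type*} [Category* C'] [MonoidalCategory C'] (F : C ⥤ C') [F.Monoidal]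

/-- Monoidal functors preserve tensor powers. -/
noncomputable def mapTensorPow (V : C) : (n : ℕ) → (F.obj (tensorPow V n) ≅ tensorPow (F.obj V) n)
  | 0 => (Functor.Monoidal.εIso F).symm
  | n + 1 => (Functor.Monoidal.μIso F V (tensorPow V n)).symm ≪≫
      whiskerLeftIso (F.obj V) (mapTensorPow V n)

theorem mapTensorPow_zero_hom (V : C) : (mapTensorPow F V 0).hom = η F := rfl

theorem mapTensorPow_succ_hom (V : C) (n : ℕ) : (mapTensorPow F V (n + 1)).hom =
    δ F V (tensorPow V n) ≫ F.obj V ◁ (mapTensorPow F V n).hom := rfl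

/-- No braiding is involved: `cycIso` is built from associators and unitors, so coherence of the
monoidal functor suffices. -/
theorem map_cycIso (V : C) (n : ℕ) :
    F.map (cycIso V n).hom ≫ δ F _ _ ≫ F.obj V ◁ (mapTensorPow F V n).hom =
      δ F _ _ ≫ (mapTensorPow F V n).hom ▷ F.obj V ≫ (cycIso (F.obj V) n).hom := by
  induction n with
  | zero =>
    rw [cycIso_zero_hom, cycIso_zero_hom, mapTensorPow_zero_hom]
    simp [tensorPow]
  | succ n ih =>
    rw [cycIso_succ_hom, cycIso_succ_hom, mapTensorPow_succ_hom]
    dsimp only [tensorPow]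
    simp only [Functor.map_comp, MonoidalCategory.whiskerLeft_comp, Category.assoc,
      comp_whiskerRight]
    rw [← Functor.OplaxMonoidal.δ_natural_right_assoc, ← MonoidalCategory.whiskerLeft_comp,
      ← MonoidalCategory.whiskerLeft_comp, ih]
    simp

variable {k : Type*} [Field k] [Preadditive C] [Linear k C] [Preadditive C'] [Linear k C']
  [F.Additive] [F.Linear k] [F.Full] [F.Faithful]

variable (k) in
/-- A fully faithful linear monoidal functor preserves the invariants of tensor powers. -/
noncomputable def mapInvariants (V : C) (n : ℕ) : (𝟙_ C ⟶ V ⊗ tensorPow V n) ≃ₗ[k]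
    (𝟙_ C' ⟶ F.obj V ⊗ tensorPow (F.obj V) n) :=
  LinearEquiv.ofBijective (F.mapLinearMap k) ⟨F.map_injective, F.map_surjective⟩ ≪≫ₗ
    Linear.homCongr k (Functor.Monoidal.εIso F).symm
      ((Functor.Monoidal.μIso F V (tensorPow V n)).symm ≪≫
        whiskerLeftIso (F.obj V) (mapTensorPow F V n))

theorem mapInvariants_apply (V : C) (n : ℕ) (f : 𝟙_ C ⟶ V ⊗ tensorPow V n) :
    mapInvariants F k V n f =
      ε F ≫ F.map f ≫ δ F _ _ ≫ F.obj V ◁ (mapTensorPow F V n).hom := by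
  simp [mapInvariants, Linear.homCongr]
  rfl

variable [MonoidalPreadditive C] [MonoidalLinear k C] [MonoidalPreadditive C']
  [MonoidalLinear k C']

variable (k) in
-- A rotation replaces one mate of a morphism g out of D by the other, then reassociates. When the
-- functor matches the coevaluations it sends both mates of g to the mates of its image, so it
-- conjugates one rotation into the other.
theorem mapInvariants_rotation (V D : C) [ExactPairing V D] [ExactPairing D V]
    [ExactPairing (F.obj V) (F.obj D)] [ExactPairing (F.obj D) (F.obj V)]
    (h : F.map (η_ V D) = η F ≫ η_ _ _ ≫ μ F _ _) (h' : F.map (η_ D V) = η F ≫ η_ _ _ ≫ μ F _ _)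
    (n : ℕ) (f : 𝟙_ C ⟶ V ⊗ tensorPow V n) :
    mapInvariants F k V n (rotation V D k n f) =
      rotation (F.obj V) (F.obj D) k n (mapInvariants F k V n f) := by
  obtain ⟨g, rfl⟩ := (coev_leftMate_bijective V D _).2 f
  dsimp only
  have h1 : mapInvariants F k V n (η_ V D ≫ V ◁ g) =
      η_ (F.obj V) (F.obj D) ≫ F.obj V ◁ (F.map g ≫ (mapTensorPow F V n).hom) := by
    rw [mapInvariants_apply, F.map_comp, h]
    simp only [Category.assoc, Functor.Monoidal.ε_η_assoc, MonoidalCategory.whiskerLeft_comp]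
    rw [← μ_natural_right_assoc, Functor.Monoidal.μ_δ_assoc]
  rw [h1, rotation_apply, rotation_apply, mapInvariants_apply, F.map_comp, F.map_comp, h']
  simp only [Category.assoc, map_cycIso, Functor.Monoidal.ε_η_assoc, comp_whiskerRight]
  rw [← μ_natural_left_assoc, Functor.Monoidal.μ_δ_assoc]

variable (k) in
theorem trace_rotation_map (V D : C) [ExactPairing V D] [ExactPairing D V]
    [ExactPairing (F.obj V) (F.obj D)] [ExactPairing (F.obj D) (F.obj V)]
    (h : F.map (η_ V D) = η F ≫ η_ _ _ ≫ μ F _ _) (h' : F.map (η_ D V) = η F ≫ η_ _ _ ≫ μ F _ _)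
    (n : ℕ) :
    LinearMap.trace k _ (rotation (F.obj V) (F.obj D) k n).toLinearMap =
      LinearMap.trace k _ (rotation V D k n).toLinearMap := by
  rw [← LinearMap.trace_conj' _ (mapInvariants F k V n)]
  congr 1
  ext1 f
  obtain ⟨f, rfl⟩ := (mapInvariants F k V n).surjective f
  simp [LinearEquiv.conj_apply, mapInvariants_rotation F k V D h h']

variable (k) in
theorem trace_rotation_symm_map (V D : C) [ExactPairing V D] [ExactPairing D V]
    [ExactPairing (F.obj V) (F.obj D)] [ExactPairing (F.obj D) (F.obj V)]
    (h : F.map (η_ V D) = η F ≫ η_ _ _ ≫ μ F _ _) (h' : F.map (η_ D V) = η F ≫ η_ _ _ ≫ μ F _ _)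
    (n : ℕ) :
    LinearMap.trace k _ (rotation (F.obj V) (F.obj D) k n).symm.toLinearMap =
      LinearMap.trace k _ (rotation V D k n).symm.toLinearMap := by
  rw [← LinearMap.trace_conj' _ (mapInvariants F k V n)]
  congr 1
  ext1 f
  obtain ⟨f, rfl⟩ := ((rotation V D k n).trans (mapInvariants F k V n)).surjective f
  rw [LinearEquiv.coe_coe, LinearEquiv.symm_apply_eq]
  simp [LinearEquiv.conj_apply, ← mapInvariants_rotation F k V D h h']

end Transport

end Categorical

end HopfFS

namespace HopfFS

/-! ### Sliding elements across a tensor by the antipode -/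

section HopfIdentities

variable {k H N : Type*} [Field k] [Ring H] [HopfAlgebra k H] [AddCommGroup N] [Module k N]

open HopfAlgebra Coalgebra

/-- `(S(h₍₁₎) ⊗ 1) Δ(h₍₂₎) = 1 ⊗ h`. -/
theorem sum_antipode_tmul_one_mul_comul (h : H) :
    LinearMap.mul' k (H ⊗[k] H) (TensorProduct.map
      ((TensorProduct.mk k H H).flip 1 ∘ₗ antipode k) comul (comul (R := k) h)) =
      (1 : H) ⊗ₜ[k] h := by
  have h1 : LinearMap.mul' k (H ⊗[k] H) ∘ₗ TensorProduct.map
      ((TensorProduct.mk k H H).flip 1 ∘ₗ antipode k) comul =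
      (LinearMap.mul' k H ∘ₗ (antipode k).rTensor H).rTensor H ∘ₗ
        (TensorProduct.assoc k H H H).symm.toLinearMap ∘ₗ comul.lTensor H := by
    refine TensorProduct.ext' fun a b => ?_
    simp only [LinearMap.comp_apply, TensorProduct.map_tmul, LinearMap.lTensor_tmul]
    induction comul (R := k) b using TensorProduct.induction_on with
    | zero => simp
    | tmul x y => simp
    | add x y hx hy => simp only [map_add, TensorProduct.tmul_add, hx, hy]
  have h2 := LinearMap.congr_fun h1 (comul h)
  simp only [LinearMap.comp_apply, LinearEquiv.coe_coe, coassoc_symm_apply] at h2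
  rw [h2, ← LinearMap.comp_apply (LinearMap.rTensor _ _), ← LinearMap.rTensor_comp,
    LinearMap.comp_assoc, HopfAlgebra.mul_antipode_rTensor_comul, LinearMap.rTensor_comp,
    LinearMap.comp_apply, rTensor_counit_comul]
  simp

/-- `Δ(h₍₁₎) (1 ⊗ S(h₍₂₎)) = h ⊗ 1`. -/
theorem sum_comul_mul_one_tmul_antipode (h : H) :
    LinearMap.mul' k (H ⊗[k] H) (TensorProduct.map comul
      (TensorProduct.mk k H H 1 ∘ₗ antipode k) (comul (R := k) h)) = h ⊗ₜ[k] (1 : H) := by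
  have h1 : LinearMap.mul' k (H ⊗[k] H) ∘ₗ TensorProduct.map comul
      (TensorProduct.mk k H H 1 ∘ₗ antipode k) =
      (LinearMap.mul' k H ∘ₗ (antipode k).lTensor H).lTensor H ∘ₗ
        (TensorProduct.assoc k H H H).toLinearMap ∘ₗ comul.rTensor H := by
    refine TensorProduct.ext' fun a b => ?_
    simp only [LinearMap.comp_apply, TensorProduct.map_tmul, LinearMap.rTensor_tmul]
    induction comul (R := k) a using TensorProduct.induction_on with
    | zero => simp
    | tmul x y => simp
    | add x y hx hy => simp only [map_add, TensorProduct.add_tmul, hx, hy]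
  have h2 := LinearMap.congr_fun h1 (comul h)
  simp only [LinearMap.comp_apply, LinearEquiv.coe_coe, coassoc_apply] at h2
  rw [h2, ← LinearMap.comp_apply (LinearMap.lTensor _ _), ← LinearMap.lTensor_comp,
    LinearMap.comp_assoc, HopfAlgebra.mul_antipode_lTensor_comul, LinearMap.lTensor_comp,
    LinearMap.comp_apply, lTensor_counit_comul]
  simp

/-- Write 1 ⊗ h as (S(h₍₁₎) ⊗ 1) Δ(h₍₂₎); the hypothesis turns Δ(h₍₂₎) into ε(h₍₂₎). It is used for
invariant tensors, and its mirror image below for invariant forms and for integrals. -/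
theorem apply_one_tmul_of_mul_comul (f : H ⊗[k] H →ₗ[k] N)
    (hf : ∀ x h, f (x * comul (R := k) h) = counit (R := k) h • f x) (h : H) :
    f (1 ⊗ₜ h) = f (antipode k h ⊗ₜ 1) := by
  have h1 : f ∘ₗ LinearMap.mul' k (H ⊗[k] H) ∘ₗ TensorProduct.map
      ((TensorProduct.mk k H H).flip 1 ∘ₗ antipode k) comul =
      f ∘ₗ (TensorProduct.mk k H H).flip 1 ∘ₗ antipode k ∘ₗ
        (TensorProduct.rid k H).toLinearMap ∘ₗ counit.lTensor H := by
    refine TensorProduct.ext' fun a b => ?_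
    simp only [LinearMap.comp_apply, TensorProduct.map_tmul, LinearMap.mul'_apply, hf,
      LinearMap.lTensor_tmul, LinearEquiv.coe_coe, TensorProduct.rid_tmul, map_smul,
      LinearMap.flip_apply]
  have h2 := LinearMap.congr_fun h1 (comul h)
  simpa only [LinearMap.comp_apply, sum_antipode_tmul_one_mul_comul, lTensor_counit_comul,
    LinearEquiv.coe_coe, TensorProduct.rid_tmul, one_smul, LinearMap.flip_apply,
    TensorProduct.mk_apply] using h2

theorem apply_tmul_one_of_comul_mul (f : H ⊗[k] H →ₗ[k] N)
    (hf : ∀ h x, f (comul (R := k) h * x) = counit (R := k) h • f x) (h : H) :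
    f (h ⊗ₜ 1) = f (1 ⊗ₜ antipode k h) := by
  have h1 : f ∘ₗ LinearMap.mul' k (H ⊗[k] H) ∘ₗ TensorProduct.map comul
      (TensorProduct.mk k H H 1 ∘ₗ antipode k) =
      f ∘ₗ TensorProduct.mk k H H 1 ∘ₗ antipode k ∘ₗ
        (TensorProduct.lid k H).toLinearMap ∘ₗ counit.rTensor H := by
    refine TensorProduct.ext' fun a b => ?_
    simp [hf]
  have h2 := LinearMap.congr_fun h1 (comul h)
  simpa only [LinearMap.comp_apply, sum_comul_mul_one_tmul_antipode, rTensor_counit_comul,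
    LinearEquiv.coe_coe, TensorProduct.lid_tmul, one_smul, TensorProduct.mk_apply] using h2

end HopfIdentities

/-! ### Integrals of a semisimple Hopf algebra and the element u -/

section Integrals

variable {k : Type u} {H : Type u} [Field k] [Ring H]

open Coalgebra

section Bialgebra

variable [Bialgebra k H]

theorem IsLeftIntegral.mul_right {Λ : H} (hΛ : IsLeftIntegral k Λ) (x : H) :
    IsLeftIntegral k (Λ * x) := fun h => by
  rw [← mul_assoc, hΛ h, smul_mul_assoc]

/-- The left ideal of integrals with vanishing counit. -/
def counitKerIntegrals (k H : Type u) [Field k] [Ring H] [Bialgebra k H] : Submodule H H where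
  carrier := {x | IsLeftIntegral k x ∧ counit (R := k) x = 0}
  add_mem' {a b} ha hb := ⟨fun h => by rw [mul_add, ha.1, hb.1, smul_add], by
    rw [map_add, ha.2, hb.2, add_zero]⟩
  zero_mem' := ⟨fun h => by simp, map_zero _⟩
  smul_mem' h x hx := by
    have e : h • x = counit (R := k) h • x := hx.1 h
    refine ⟨fun g => ?_, ?_⟩
    · rw [e, mul_smul_comm, hx.1, smul_comm]
    · rw [e, map_smul, hx.2, smul_zero]

variable [IsSemisimpleRing H]

/-- Integrals with vanishing counit form a left ideal K that x annihilates from the left. Splitting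
1 along a complement N of K puts x in N as well as in K. -/
theorem IsLeftIntegral.eq_zero_of_counit {x : H} (hx : IsLeftIntegral k x)
    (h0 : counit (R := k) x = 0) : x = 0 := by
  obtain ⟨N, hN⟩ := exists_isCompl (counitKerIntegrals k H)
  have hxm : x ∈ counitKerIntegrals k H := ⟨hx, h0⟩
  obtain ⟨f, hf, g, hg, hfg⟩ := Submodule.mem_sup.1
    (hN.sup_eq_top ▸ Submodule.mem_top : (1 : H) ∈ counitKerIntegrals k H ⊔ N)
  have hxf : x * f = 0 := by rw [hf.1, h0, zero_smul]
  have hxg : x = x * g := by rw [← zero_add (x * g), ← hxf, ← mul_add, hfg, mul_one]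
  have : x ∈ N := by rw [hxg]; exact N.smul_mem x hg
  exact (Submodule.disjoint_def.1 hN.disjoint) x hxm this

theorem IsLeftIntegral.counit_ne_zero {Λ : H} (hΛ : IsLeftIntegral k Λ) (h0 : Λ ≠ 0) :
    counit (R := k) Λ ≠ 0 :=
  fun h => h0 (hΛ.eq_zero_of_counit h)

/-- The difference Λh - ε(h)Λ is a left integral of counit zero, so left integrals are also right
integrals. -/
theorem IsLeftIntegral.mul_eq {Λ : H} (hΛ : IsLeftIntegral k Λ) (h : H) :
    Λ * h = counit (R := k) h • Λ := by
  rw [← sub_eq_zero]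
  refine IsLeftIntegral.eq_zero_of_counit (k := k) (fun g => ?_) ?_
  · rw [mul_sub, hΛ.mul_right h g, mul_smul_comm, hΛ, smul_sub, smul_comm]
  · simp [mul_comm]

theorem exists_leftIntegral (k H : Type u) [Field k] [Ring H] [Bialgebra k H]
    [IsSemisimpleRing H] : ∃ Λ : H, Λ ≠ 0 ∧ IsLeftIntegral k Λ := by
  -- The integral is the component of 1 in a complement of ker ε: hg - ε(h)g lies both in ker ε and
  -- in the complement.
  let I : Submodule H H := RingHom.ker (Bialgebra.counitAlgHom k H)
  obtain ⟨N, hN⟩ := exists_isCompl I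
  obtain ⟨f, hf, g, hg, hfg⟩ := Submodule.mem_sup.1
    (hN.sup_eq_top ▸ Submodule.mem_top : (1 : H) ∈ I ⊔ N)
  have hmem : ∀ x : H, x ∈ I ↔ counit (R := k) x = 0 := fun x => Iff.rfl
  refine ⟨g, ?_, fun h => ?_⟩
  · rintro rfl
    rw [add_zero] at hfg
    rw [hfg, hmem, Bialgebra.counit_one] at hf
    exact one_ne_zero hf
  · rw [← sub_eq_zero]
    refine (Submodule.disjoint_def.1 hN.disjoint) _ ?_ ?_
    · rw [hmem]; simp
    · refine N.sub_mem (N.smul_mem h hg) ?_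
      rw [Algebra.smul_def]
      exact N.smul_mem _ hg

end Bialgebra

variable [HopfAlgebra k H]

open HopfAlgebra

/-- Since Λ is also a right integral, Δ(Λ)(h ⊗ 1) = Δ(Λ)(1 ⊗ S(h)). Applying a ⊗ b ↦ S(b)a gives the
identity. -/
theorem uElem_mul [IsSemisimpleRing H] {Λ : H} (hΛ : IsLeftIntegral k Λ) (h : H) :
    uElem k Λ * h = antipode k (antipode k h) * uElem k Λ := by
  let m : H ⊗[k] H →ₗ[k] H := LinearMap.mul' k H ∘ₗ
    TensorProduct.map (antipode k) LinearMap.id ∘ₗ (TensorProduct.comm k H H).toLinearMap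
  have hm1 : ∀ x, m (x * h ⊗ₜ 1) = m x * h := fun x => by
    induction x using TensorProduct.induction_on with
    | zero => simp
    | tmul a b => simp [m, mul_assoc]
    | add x y hx hy => rw [add_mul, map_add, hx, hy, map_add, add_mul]
  have hm2 : ∀ x, m (x * 1 ⊗ₜ antipode k h) = antipode k (antipode k h) * m x := fun x => by
    induction x using TensorProduct.induction_on with
    | zero => simp
    | tmul a b => simp [m, mul_assoc, antipode_mul_antidistrib]
    | add x y hx hy => rw [add_mul, map_add, hx, hy, map_add, mul_add]
  have key := apply_tmul_one_of_comul_mul (m ∘ₗ LinearMap.mulLeft k (comul (R := k) Λ))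
    (fun g x => by
      rw [LinearMap.comp_apply, LinearMap.mulLeft_apply, ← mul_assoc, ← Bialgebra.comul_mul,
        hΛ.mul_eq, map_smul, smul_mul_assoc, map_smul]; rfl) h
  simp only [LinearMap.comp_apply, LinearMap.mulLeft_apply, hm1, hm2] at key
  exact key

/-- Under the trace S(Λ₍₂₎)Λ₍₁₎ may be replaced by Λ₍₁₎S(Λ₍₂₎) = ε(Λ)1. -/
theorem character_uElem (V : FinRep k H) (Λ : H) :
    V.character (uElem k Λ) = counit (R := k) Λ * Module.finrank k V := by
  have h : (LinearMap.trace k V ∘ₗ V.ρ.toLinearMap) ∘ₗ LinearMap.mul' k H ∘ₗ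
      TensorProduct.map (antipode k) LinearMap.id ∘ₗ (TensorProduct.comm k H H).toLinearMap =
      (LinearMap.trace k V ∘ₗ V.ρ.toLinearMap) ∘ₗ LinearMap.mul' k H ∘ₗ
        (antipode k).lTensor H := by
    refine TensorProduct.ext' fun a b => ?_
    simpa using LinearMap.trace_mul_comm k (V.ρ (antipode k b)) (V.ρ a)
  have h2 := LinearMap.congr_fun h (comul Λ)
  rw [LinearMap.comp_apply _ (_ ∘ₗ LinearMap.lTensor _ _),
    LinearMap.comp_apply _ (LinearMap.lTensor _ _), mul_antipode_lTensor_comul_apply] at h2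
  refine h2.trans ?_
  simp [Algebra.algebraMap_eq_smul_one]

end Integrals

end HopfFS

/-! ### Decomposition of representations and the dimension bound -/

namespace FinRep

variable {k H : Type u} [Field k] [Ring H] [Algebra k H]

/-- The `H`-module structure of a representation. -/
abbrev toModule (V : FinRep k H) : Module H V := Module.compHom V V.ρ.toRingHom

/-- The representation on a finite-dimensional `H`-module. -/
def ofModule (k H M : Type u) [Field k] [Ring H] [Algebra k H] [AddCommGroup M] [Module k M]
    [Module H M] [IsScalarTower k H M] [Module.Finite k M] : FinRep k H where
  carrier := M
  ρ := Algebra.lsmul k k M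

/-- A nonzero representation all of whose endomorphisms are scalars. -/
def IsSchur (V : FinRep k H) : Prop :=
  Nontrivial V ∧ ∀ f : V ⟶ V, ∃ a : k, f = a • 𝟙 V

/-- A morphism of representations as a linear map of `H`-modules. -/
def homToLinearMap {V W : FinRep k H} (f : V ⟶ W) :
    letI := V.toModule; letI := W.toModule; V →ₗ[H] W :=
  letI := V.toModule; letI := W.toModule
  { toFun := f.lin
    map_add' := f.lin.map_add
    map_smul' := fun h v => f.comm h v }

/-- A linear map of `H`-modules as a morphism of representations. -/
def homOfLinearMap {V W : FinRep k H} (f : letI := V.toModule; letI := W.toModule; V →ₗ[H] W) :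
    V ⟶ W :=
  letI := V.toModule; letI := W.toModule
  { lin :=
      { toFun := f
        map_add' := f.map_add
        map_smul' := fun c v => by
          have := f.map_smul (algebraMap k H c) v
          change f (V.ρ _ v) = W.ρ _ (f v) at this
          simpa [Algebra.algebraMap_eq_smul_one] using this }
    comm := fun h v => f.map_smul h v }

theorem character_eq_of_decomposition {V W W' : FinRep k H} (i : W ⟶ V) (p : V ⟶ W) (i' : W' ⟶ V)
    (p' : V ⟶ W') (h : i ≫ p = 𝟙 W) (h' : i' ≫ p' = 𝟙 W') (hs : p ≫ i + p' ≫ i' = 𝟙 V) (x : H) :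
    V.character x = W.character x + W'.character x := by
  have key : ∀ {U : FinRep k H} (i : U ⟶ V) (p : V ⟶ U), i ≫ p = 𝟙 U →
      LinearMap.trace k V (V.ρ x ∘ₗ i.lin ∘ₗ p.lin) = U.character x := fun {U} i p h => by
    have h1 : V.ρ x ∘ₗ i.lin = i.lin ∘ₗ U.ρ x := LinearMap.ext fun v => (i.comm x v).symm
    have h2 : p.lin ∘ₗ i.lin = LinearMap.id := congrArg Hom.lin h
    rw [← LinearMap.comp_assoc, h1, LinearMap.comp_assoc, LinearMap.trace_comp_comm',
      LinearMap.comp_assoc, h2, LinearMap.comp_id]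
    rfl
  have hs' : i.lin ∘ₗ p.lin + i'.lin ∘ₗ p'.lin = LinearMap.id := congrArg Hom.lin hs
  rw [← key i p h, ← key i' p' h', ← map_add, ← LinearMap.comp_add, hs', LinearMap.comp_id]
  rfl

variable [IsSemisimpleRing H]

/-- A representation with a non-scalar endomorphism decomposes. -/
theorem exists_decomposition [IsAlgClosed k] (V : FinRep k H) [Nontrivial V] (hV : ¬ IsSchur V) :
    ∃ (W W' : FinRep k H) (i : W ⟶ V) (p : V ⟶ W) (i' : W' ⟶ V) (p' : V ⟶ W'),
      i ≫ p = 𝟙 W ∧ i' ≫ p' = 𝟙 W' ∧ p ≫ i + p' ≫ i' = 𝟙 V ∧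
      Module.finrank k W < Module.finrank k V ∧ Module.finrank k W' < Module.finrank k V := by
  let := V.toModule
  have : IsScalarTower k H V := ⟨fun c h v => by
    change V.ρ (c • h) v = c • V.ρ h v
    simp⟩
  simp only [IsSchur, not_and, not_forall, not_exists] at hV
  obtain ⟨f, hf⟩ := hV inferInstance
  obtain ⟨a, ha⟩ := Module.End.exists_eigenvalue (K := k) f.lin
  -- The eigenspace of a non-scalar endomorphism is a proper nonzero submodule; semisimplicity
  -- supplies its complement.
  let N : Submodule H V := LinearMap.ker (homToLinearMap (f - a • 𝟙 V))
  have hmem : ∀ v, v ∈ N ↔ f.lin v = a • v := fun v => by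
    change f.lin v - a • v = 0 ↔ _
    rw [sub_eq_zero]
  obtain ⟨N', hN⟩ := exists_isCompl N
  have hN_bot : N ≠ ⊥ := by
    obtain ⟨v, hv⟩ := ha.exists_hasEigenvector
    intro h
    exact hv.2 ((Submodule.eq_bot_iff N).1 h v ((hmem v).2 hv.apply_eq_smul))
  have hN_top : N ≠ ⊤ := by
    intro h
    refine hf a (hom_ext (LinearMap.ext fun v => ?_))
    exact (hmem v).1 (h ▸ Submodule.mem_top)
  have hN'_top : N' ≠ ⊤ := by
    rintro rfl
    exact hN_bot (eq_bot_of_isCompl_top hN)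
  have hrank : ∀ P : Submodule H V, P ≠ ⊤ → Module.finrank k P < Module.finrank k V :=
    fun P hP => Submodule.finrank_lt (s := P.restrictScalars k)
      (by rwa [Ne, Submodule.restrictScalars_eq_top_iff])
  have hN'' := hN.symm
  have hfin : ∀ P : Submodule H V, Module.Finite k P := fun P =>
    inferInstanceAs (Module.Finite k (P.restrictScalars k))
  have := hfin N
  have := hfin N'
  refine ⟨ofModule k H N, ofModule k H N',
    ⟨N.subtype.restrictScalars k, fun _ _ => rfl⟩,
    ⟨(N.projectionOnto N' hN).restrictScalars k, fun h v => (N.projectionOnto N' hN).map_smul h v⟩,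
    ⟨N'.subtype.restrictScalars k, fun _ _ => rfl⟩,
    ⟨(N'.projectionOnto N hN'').restrictScalars k, fun h v => (N'.projectionOnto N hN'').map_smul h v⟩,
    ?_, ?_, ?_, hrank N hN_top, hrank N' hN'_top⟩
  · exact hom_ext (LinearMap.ext fun v => Submodule.projectionOnto_apply_left hN v)
  · exact hom_ext (LinearMap.ext fun v => Submodule.projectionOnto_apply_left hN'' v)
  · exact hom_ext (LinearMap.ext fun v =>
      Submodule.projection_add_projection_eq_self hN v)

/-- Representations with scalar endomorphisms only satisfy `(dim V)² ≤ dim H`. -/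
theorem IsSchur.finrank_sq_le [Module.Finite k H] {V : FinRep k H} (hV : IsSchur V) :
    Module.finrank k V ^ 2 ≤ Module.finrank k H := by
  let := V.toModule
  have : IsScalarTower k H V := ⟨fun c h v => by
    change V.ρ (c • h) v = c • V.ρ h v
    simp⟩
  have hscalar : ∀ g : Module.End H V, ∃ a : k, ∀ v : V, g v = a • v := fun g => by
    obtain ⟨a, ha⟩ := hV.2 (homOfLinearMap (V := V) (W := V) g)
    exact ⟨a, fun v => LinearMap.congr_fun (congrArg Hom.lin ha) v⟩
  -- With only scalar endomorphisms, every k-linear map commutes with them. Jacobson density on a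
  -- finite spanning set then puts it in the image of H.
  have hsurj : Function.Surjective V.ρ := fun f => by
    obtain ⟨s, hs⟩ := Module.Finite.fg_top (R := k) (M := V)
    let f' : Module.End (Module.End H V) V :=
      { toFun := f
        map_add' := f.map_add
        map_smul' := fun g v => by
          obtain ⟨a, ha⟩ := hscalar g
          simp [ha] }
    obtain ⟨r, hr⟩ := jacobson_density f' s
    refine ⟨r, ?_⟩
    refine LinearMap.ext_on hs fun v hv => ?_
    exact (hr v hv).symm
  calc Module.finrank k V ^ 2 = Module.finrank k (Module.End k V) := by
        rw [Module.finrank_linearMap, sq]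
    _ ≤ Module.finrank k H := LinearMap.finrank_le_finrank_of_surjective (f := V.ρ.toLinearMap) hsurj

end FinRep

/-! ### Invertibility of u -/

namespace HopfFS

variable {k H : Type u} [Field k] [IsAlgClosed k] [Ring H] [HopfAlgebra k H]
  [Module.Finite k H] [IsSemisimpleRing H]

open HopfAlgebra

theorem isUnit_uElem (hdim : ∀ V : FinRep k H, V.IsSchur → (Module.finrank k V : k) ≠ 0) {Λ : H}
    (hΛ : IsLeftIntegral k Λ) (h0 : Λ ≠ 0) : IsUnit (uElem k Λ) := by
  -- The right annihilator of u is a left ideal because u h = S²(h) u. A simple submodule A of it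
  -- would have u acting by zero, although the trace of u on A is ε(Λ) dim A ≠ 0.
  let N : Submodule H H :=
    { carrier := {x | uElem k Λ * x = 0}
      add_mem' := fun {a b} ha hb => by
        change _ * (a + b) = 0
        rw [mul_add, ha, hb, add_zero]
      zero_mem' := mul_zero _
      smul_mem' := fun h x hx => by
        change _ * (h * x) = 0
        rw [← mul_assoc, uElem_mul hΛ, mul_assoc, hx, mul_zero] }
  have hN : N = ⊥ := by
    by_contra hne
    obtain ⟨A, hA, hAN⟩ := (eq_bot_or_exists_atom_le N).resolve_left hne
    have : IsSimpleModule H A := isSimpleModule_iff_isAtom.2 hA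
    let W := FinRep.ofModule k H A
    have hW : W.IsSchur := by
      refine ⟨IsSimpleModule.nontrivial H A, fun f => ?_⟩
      let f' : Module.End H A :=
        { toFun := f.lin
          map_add' := f.lin.map_add
          map_smul' := fun h v => f.comm h v }
      obtain ⟨a, ha⟩ := (IsSimpleModule.algebraMap_end_bijective_of_isAlgClosed k).2 f'
      exact ⟨a, FinRep.hom_ext (LinearMap.ext fun v => (LinearMap.congr_fun ha v).symm)⟩
    refine mul_ne_zero (hΛ.counit_ne_zero h0) (hdim W hW) ?_
    rw [← character_uElem W Λ]
    have : W.ρ (uElem k Λ) = 0 := LinearMap.ext fun x => Subtype.ext (hAN x.2)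
    rw [FinRep.character, this, map_zero]
  have hinj : Function.Injective (LinearMap.mulLeft k (uElem k Λ)) := by
    rw [← LinearMap.ker_eq_bot, Submodule.eq_bot_iff]
    exact fun x hx => (Submodule.eq_bot_iff N).1 hN x hx
  obtain ⟨v, hv⟩ := (LinearMap.injective_iff_surjective.1 hinj) 1
  have hv' : uElem k Λ * v = 1 := hv
  exact ⟨⟨uElem k Λ, v, hv', hinj (by
    simp only [LinearMap.mulLeft_apply]
    rw [← mul_assoc, hv', one_mul, mul_one])⟩, rfl⟩

end HopfFS

/-! ### Hom dimensions and preservation of dimension by tensor equivalences -/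

namespace FinRep

variable {k H : Type u} [Field k] [Ring H]

section Monoidal

open MonoidalCategory

variable [Bialgebra k H]

instance : MonoidalPreadditive (FinRep k H) where
  whiskerLeft_zero := hom_ext (TensorProduct.map_zero_right _)
  zero_whiskerRight := hom_ext (TensorProduct.map_zero_left _)
  whiskerLeft_add f g := hom_ext (TensorProduct.map_add_right _ f.lin g.lin)
  add_whiskerRight f g := hom_ext (TensorProduct.map_add_left f.lin g.lin _)

instance : MonoidalLinear k (FinRep k H) where
  whiskerLeft_smul _ _ _ r f := hom_ext (TensorProduct.map_smul_right r _ f.lin)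
  smul_whiskerRight r _ _ f _ := hom_ext (TensorProduct.map_smul_left r f.lin _)

theorem finrank_tensorPow (V : FinRep k H) (n : ℕ) :
    Module.finrank k (HopfFS.tensorPow V n : FinRep k H) = Module.finrank k V ^ n := by
  induction n with
  | zero => exact Module.finrank_self k
  | succ n ih =>
    rw [pow_succ', ← ih]
    exact Module.finrank_tensorProduct (R := k) (M := V) (M' := (HopfFS.tensorPow V n : FinRep k H))

end Monoidal

section Algebra

variable [Algebra k H]

/-- Morphisms of representations as linear maps. -/
def linₗ (V W : FinRep k H) : (V ⟶ W) →ₗ[k] (V →ₗ[k] W) where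
  toFun f := f.lin
  map_add' _ _ := rfl
  map_smul' _ _ := rfl

theorem linₗ_injective (V W : FinRep k H) : Function.Injective (linₗ V W) := lin_injective V W

instance (V W : FinRep k H) : Module.Finite k (V ⟶ W) :=
  Module.Finite.of_injective (linₗ V W) (linₗ_injective V W)

theorem finrank_hom_le (V W : FinRep k H) :
    Module.finrank k (V ⟶ W) ≤ Module.finrank k V * Module.finrank k W := by
  rw [← Module.finrank_linearMap k k]
  exact LinearMap.finrank_le_finrank_of_injective (linₗ_injective V W)

variable [Module.Finite k H]

variable (k H) in
/-- The regular representation. -/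
def regular : FinRep k H := ofModule k H H

/-- A morphism from the regular representation is determined by the image of `1`. -/
def regularHomEquiv (V : FinRep k H) : (regular k H ⟶ V) ≃ₗ[k] V where
  toFun f := f.lin (1 : H)
  map_add' _ _ := rfl
  map_smul' _ _ := rfl
  invFun v := ⟨(LinearMap.applyₗ v ∘ₗ V.ρ.toLinearMap : H →ₗ[k] V), fun h (x : H) => by
    change V.ρ (h * x) v = V.ρ h (V.ρ x v)
    rw [map_mul]; rfl⟩
  left_inv f := hom_ext (LinearMap.ext fun (h : H) => by
    change V.ρ h (f.lin (1 : H)) = f.lin h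
    rw [← f.comm h (1 : H)]
    exact congrArg f.lin (mul_one h))
  right_inv v := by
    change V.ρ 1 v = v
    rw [map_one]; rfl

theorem finrank_regular_hom (V : FinRep k H) :
    Module.finrank k (regular k H ⟶ V) = Module.finrank k V :=
  (regularHomEquiv V).finrank_eq

end Algebra

section Transport

variable {H' : Type u} [Ring H'] [Bialgebra k H] [Bialgebra k H']
  (F : FinRep k H ⥤ FinRep k H') [F.Additive] [F.Linear k]

theorem finrank_map_hom [F.Full] [F.Faithful] (V W : FinRep k H) :
    Module.finrank k (F.obj V ⟶ F.obj W) = Module.finrank k (V ⟶ W) :=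
  (LinearEquiv.ofBijective (F.mapLinearMap k (X := V) (Y := W))
    ⟨F.map_injective, F.map_surjective⟩).finrank_eq.symm

/-- If a > b > 0, the powers of a/b would outgrow the constant C; b = 0 is settled by n = 1. -/
theorem le_of_forall_pow_le {a b C : ℕ} (h : ∀ n, a ^ n ≤ C * b ^ n) : a ≤ b := by
  by_contra! hab
  rcases Nat.eq_zero_or_pos b with rfl | hb
  · have := h 1
    simp at this
    omega
  · have hb' : (0 : ℝ) < b := by exact_mod_cast hb
    obtain ⟨n, hn⟩ := pow_unbounded_of_one_lt (C : ℝ) (y := (a : ℝ) / b)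
      ((one_lt_div hb').2 (by exact_mod_cast hab))
    rw [div_pow, lt_div_iff₀ (by positivity)] at hn
    exact absurd (h n) (by exact_mod_cast hn.not_ge)

theorem IsSchur.of_iso {V W : FinRep k H} (e : V ≅ W) (hV : V.IsSchur) : W.IsSchur := by
  have h1 : Function.LeftInverse e.inv.lin e.hom.lin := fun v =>
    LinearMap.congr_fun (congrArg Hom.lin e.hom_inv_id) v
  have := hV.1
  refine ⟨h1.injective.nontrivial, fun f => ?_⟩
  obtain ⟨a, ha⟩ := hV.2 (e.hom ≫ f ≫ e.inv)
  refine ⟨a, ?_⟩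
  rw [← cancel_epi e.hom, ← cancel_mono e.inv, Category.assoc, ha]
  simp

theorem finrank_eq_of_iso {V W : FinRep k H} (e : V ≅ W) :
    Module.finrank k V = Module.finrank k W :=
  LinearEquiv.finrank_eq
    { e.hom.lin with
      invFun := e.inv.lin
      left_inv := fun v => LinearMap.congr_fun (congrArg Hom.lin e.hom_inv_id) v
      right_inv := fun v => LinearMap.congr_fun (congrArg Hom.lin e.inv_hom_id) v }

variable [Module.Finite k H] [Module.Finite k H'] [F.Monoidal] [F.IsEquivalence]

/-- Tensor equivalences preserve dimensions. -/
theorem finrank_map (V : FinRep k H) :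
    Module.finrank k (F.obj V) = Module.finrank k V := by
  apply le_antisymm
  -- The n-th power of dim F(V) is dim Hom(regular, F(V)^{⊗n}) = dim Hom(G, V^{⊗n}), at most dim G
  -- times the n-th power of dim V.
  · let G := F.objPreimage (regular k H')
    refine le_of_forall_pow_le (C := Module.finrank k G) fun n => ?_
    rw [← finrank_tensorPow, ← finrank_tensorPow, ← finrank_regular_hom,
      ← (Linear.homCongr k (F.objObjPreimageIso (regular k H'))
        (HopfFS.mapTensorPow F V n)).finrank_eq, finrank_map_hom]
    exact finrank_hom_le _ _
  · refine le_of_forall_pow_le (C := Module.finrank k (F.obj (regular k H))) fun n => ?_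
    rw [← finrank_tensorPow, ← finrank_tensorPow, ← finrank_regular_hom, ← finrank_map_hom F,
      (Linear.homCongr k (Iso.refl _) (HopfFS.mapTensorPow F V n)).finrank_eq]
    exact finrank_hom_le _ _

theorem isSchur_map_iff (V : FinRep k H) : (F.obj V).IsSchur ↔ V.IsSchur := by
  have h1 : Nontrivial (F.obj V) ↔ Nontrivial V := by
    rw [← Module.finrank_pos_iff (R := k), finrank_map, Module.finrank_pos_iff]
  refine and_congr h1 ⟨fun h f => ?_, fun h f => ?_⟩
  · obtain ⟨a, ha⟩ := h (F.map f)
    exact ⟨a, F.map_injective (by rw [ha, Functor.map_smul, F.map_id])⟩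
  · obtain ⟨f, rfl⟩ := F.map_surjective f
    obtain ⟨a, rfl⟩ := h f
    exact ⟨a, by rw [Functor.map_smul, F.map_id]⟩

end Transport

end FinRep

/-! ### Invariant forms, exact pairings and two-sided duals -/

namespace FinRep

variable {k H : Type u} [Field k] [Ring H]

open MonoidalCategory Coalgebra HopfAlgebra HopfFS

section Bialgebra

variable [Bialgebra k H]

theorem tensorAction_eq_sum {M N ι : Type*} [AddCommGroup M] [Module k M] [AddCommGroup N]
    [Module k N] (ρ : H →ₐ[k] Module.End k M) (σ : H →ₐ[k] Module.End k N) {h : H}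
    (r : Repr k h ι) :
    tensorAction ρ σ h = ∑ i ∈ r.index, TensorProduct.map (ρ (r.left i)) (σ (r.right i)) := by
  refine TensorProduct.ext' fun v w => ?_
  rw [tensorAction_tmul, ← r.eq]
  simp

/-- The morphism from the trivial representation given by an invariant vector. -/
noncomputable def homOfInvariant (W : FinRep k H) (w : W) (hw : ∀ h, W.ρ h w = counit (R := k) h • w) :
    𝟙_ (FinRep k H) ⟶ W where
  lin := LinearMap.toSpanSingleton k W w
  comm h (c : k) := by
    change (counit (R := k) h * c) • w = W.ρ h (c • w)
    rw [map_smul, hw, smul_smul, mul_comm]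

/-- The invariant vector of a morphism from the trivial representation. -/
noncomputable def vec {W : FinRep k H} : (𝟙_ (FinRep k H) ⟶ W) →ₗ[k] W where
  toFun f := f.lin (1 : k)
  map_add' _ _ := rfl
  map_smul' _ _ := rfl

/-- The invariant tensor of a morphism from the trivial representation. -/
noncomputable def tvec {X Y : FinRep k H} : (𝟙_ (FinRep k H) ⟶ X ⊗ Y) →ₗ[k] X ⊗[k] Y := vec

/-- The invariant form of a morphism to the trivial representation. -/
def form {X Y : FinRep k H} (f : X ⊗ Y ⟶ 𝟙_ (FinRep k H)) : X ⊗[k] Y →ₗ[k] k := f.lin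

theorem ρ_vec {W : FinRep k H} (f : 𝟙_ (FinRep k H) ⟶ W) (h : H) :
    W.ρ h (vec f) = counit (R := k) h • vec f := by
  refine (f.comm h (1 : k)).symm.trans ?_
  exact f.lin.map_smul (counit (R := k) h) (1 : k)

theorem vec_injective {W : FinRep k H} :
    Function.Injective (vec : (𝟙_ (FinRep k H) ⟶ W) →ₗ[k] W) := fun _ _ h =>
  hom_ext (LinearMap.ext_ring (R := k) h)

theorem vec_homOfInvariant (W : FinRep k H) (w : W) (hw) : vec (homOfInvariant W w hw) = w :=
  one_smul k w

theorem form_ρ {X Y : FinRep k H} (f : X ⊗ Y ⟶ 𝟙_ (FinRep k H)) (h : H) (w : X ⊗[k] Y) :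
    form f (tensorAction X.ρ Y.ρ h w) = counit (R := k) h • form f w := f.comm h w

/-- The explicit form of an exact pairing of representations. -/
theorem exists_sum_of_exactPairing (X Y : FinRep k H) [ExactPairing X Y] :
    ∃ (n : ℕ) (x : Fin n → X) (y : Fin n → Y),
      tvec (η_ X Y) = ∑ i, x i ⊗ₜ[k] y i ∧
      (∀ v : X, ∑ i, form (ε_ X Y) (y i ⊗ₜ[k] v) • x i = v) ∧
      (∀ v : Y, ∑ i, form (ε_ X Y) (v ⊗ₜ[k] x i) • y i = v) := by
  obtain ⟨n, x, y, hxy⟩ : ∃ (n : ℕ) (x : Fin n → X) (y : Fin n → Y),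
      tvec (η_ X Y) = ∑ i, x i ⊗ₜ[k] y i := by
    obtain ⟨S, hS⟩ := TensorProduct.exists_finset (R := k) (tvec (η_ X Y))
    refine ⟨S.card, fun i => (S.equivFin.symm i).1.1, fun i => (S.equivFin.symm i).1.2, ?_⟩
    rw [hS, ← Finset.sum_coe_sort S, ← S.equivFin.symm.sum_comp]
  refine ⟨n, x, y, hxy, fun v => ?_, fun v => ?_⟩
  · have h := congrArg Hom.lin (ExactPairing.evaluation_coevaluation X Y)
    have h2 := LinearMap.congr_fun h ((1 : k) ⊗ₜ[k] v)
    change TensorProduct.map LinearMap.id (form (ε_ X Y))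
      (TensorProduct.assoc k X Y X (tvec (η_ X Y) ⊗ₜ[k] v)) =
        (TensorProduct.rid k X).symm (TensorProduct.lid k X ((1 : k) ⊗ₜ[k] v)) at h2
    rw [hxy] at h2
    have h3 := congrArg (TensorProduct.rid k X) h2
    simpa [TensorProduct.sum_tmul] using h3
  · have h := congrArg Hom.lin (ExactPairing.coevaluation_evaluation X Y)
    have h2 := LinearMap.congr_fun h (v ⊗ₜ[k] (1 : k))
    change TensorProduct.map (form (ε_ X Y)) LinearMap.id
      ((TensorProduct.assoc k Y X Y).symm (v ⊗ₜ[k] tvec (η_ X Y))) =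
        (TensorProduct.lid k Y).symm (TensorProduct.rid k Y (v ⊗ₜ[k] (1 : k))) at h2
    rw [hxy] at h2
    have h3 := congrArg (TensorProduct.lid k Y) h2
    simpa [TensorProduct.tmul_sum] using h3

end Bialgebra

variable [HopfAlgebra k H]

theorem form_ρ_tmul {X Y : FinRep k H} (f : Y ⊗ X ⟶ 𝟙_ (FinRep k H)) (g : H) (y : Y) (x : X) :
    form f (Y.ρ g y ⊗ₜ[k] x) = form f (y ⊗ₜ[k] X.ρ (antipode k g) x) := by
  let A : H ⊗[k] H →ₐ[k] Module.End k (Y ⊗[k] X) :=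
    (Module.endTensorEndAlgHom (R := k) (S := k) (A := k) (M := Y) (N := X)).comp
      (Algebra.TensorProduct.map Y.ρ X.ρ)
  have hA : ∀ a b, A (a ⊗ₜ b) (y ⊗ₜ x) = Y.ρ a y ⊗ₜ[k] X.ρ b x := fun a b => rfl
  have hΔ : ∀ h, A (comul (R := k) h) = tensorAction Y.ρ X.ρ h := fun h => rfl
  have := apply_tmul_one_of_comul_mul
    (form f ∘ₗ (LinearMap.applyₗ (y ⊗ₜ[k] x) : Module.End k (Y ⊗[k] X) →ₗ[k] _) ∘ₗ A.toLinearMap)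
    (fun h z => by
      simp only [LinearMap.comp_apply, AlgHom.toLinearMap_apply, LinearMap.applyₗ_apply_apply,
        map_mul, hΔ]
      exact form_ρ f h _) g
  simpa [hA] using this

theorem map_ρ_tvec {X Y : FinRep k H} (f : 𝟙_ (FinRep k H) ⟶ X ⊗ Y) (g : H) :
    TensorProduct.map LinearMap.id (Y.ρ g) (tvec f) =
      TensorProduct.map (X.ρ (antipode k g)) LinearMap.id (tvec f) := by
  let A : H ⊗[k] H →ₐ[k] Module.End k (X ⊗[k] Y) :=
    (Module.endTensorEndAlgHom (R := k) (S := k) (A := k) (M := X) (N := Y)).comp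
      (Algebra.TensorProduct.map X.ρ Y.ρ)
  have hA : ∀ a b, A (a ⊗ₜ b) = TensorProduct.map (X.ρ a) (Y.ρ b) := fun a b => rfl
  have hΔ : ∀ h, A (comul (R := k) h) = (X ⊗ Y).ρ h := fun h => rfl
  have := apply_one_tmul_of_mul_comul
    ((LinearMap.applyₗ (tvec f) : Module.End k (X ⊗[k] Y) →ₗ[k] _) ∘ₗ A.toLinearMap)
    (fun z h => by
      simp only [LinearMap.comp_apply, AlgHom.toLinearMap_apply, LinearMap.applyₗ_apply_apply,
        map_mul, hΔ]
      rw [← map_smul]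
      exact congrArg _ (ρ_vec f h)) g
  simpa [hA, Module.End.one_eq_id] using this

/-- An exact pairing from an invariant nondegenerate form. -/
noncomputable abbrev exactPairingOfForm {X Y : FinRep k H} (f : Y ⊗ X ⟶ 𝟙_ (FinRep k H))
    {ι : Type*} [Fintype ι] (x : ι → X) (y : ι → Y)
    (hx : ∀ v : X, ∑ i, form f (y i ⊗ₜ[k] v) • x i = v)
    (hy : ∀ v : Y, ∑ i, form f (v ⊗ₜ[k] x i) • y i = v) : ExactPairing X Y where
  evaluation' := f
  coevaluation' := homOfInvariant (X ⊗ Y) (∑ i, x i ⊗ₜ[k] y i : X ⊗[k] Y) (fun h => by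
    -- Expanding the second leg by `hy` writes the identity as a sum of contractions with the `x i`,
    -- so invariance can be tested on contractions.
    let Φ : X ⊗[k] Y →ₗ[k] X ⊗[k] Y :=
      ∑ i, ((TensorProduct.mk k X Y).flip (y i)) ∘ₗ (TensorProduct.rid k X).toLinearMap ∘ₗ
        (form f ∘ₗ (TensorProduct.mk k Y X).flip (x i) : Y →ₗ[k] k).lTensor X
    have hΦ : ∀ w, Φ w = w := fun w => by
      induction w using TensorProduct.induction_on with
      | zero => simp
      | tmul a b =>
        conv_rhs => rw [← hy b, TensorProduct.tmul_sum]
        simp [Φ]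
      | add a b ha hb => rw [map_add, ha, hb]
    change tensorAction X.ρ Y.ρ h (∑ i, x i ⊗ₜ[k] y i) =
      counit (R := k) h • (∑ i, x i ⊗ₜ[k] y i : X ⊗[k] Y)
    -- Invariance of the form moves h₍₂₎ onto `x j` as S(h₍₂₎), and `hx` collapses the sum to
    -- h₍₁₎S(h₍₂₎) `x j`.
    have hmid : ∀ j, (TensorProduct.rid k X) ((form f ∘ₗ (TensorProduct.mk k Y X).flip (x j) :
        Y →ₗ[k] k).lTensor X (tensorAction X.ρ Y.ρ h (∑ i, x i ⊗ₜ[k] y i))) =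
        counit (R := k) h • x j := fun j => by
      have hr := sum_mul_antipode_eq_smul (Repr.arbitrary k h)
      have hr2 := LinearMap.congr_fun (congrArg X.ρ hr) (x j)
      rw [map_smul, map_one] at hr2
      refine Eq.trans ?_ hr2
      rw [tensorAction_eq_sum _ _ (Repr.arbitrary k h)]
      simp only [map_sum, LinearMap.sum_apply, TensorProduct.map_tmul, LinearMap.lTensor_tmul,
        LinearMap.comp_apply, LinearMap.flip_apply, TensorProduct.mk_apply, form_ρ_tmul,
        TensorProduct.rid_tmul, map_mul, Module.End.mul_apply]
      rw [Finset.sum_comm]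
      refine Finset.sum_congr rfl fun i _ => ?_
      simp only [← map_smul]
      rw [← map_sum, hx]
    rw [← hΦ (tensorAction X.ρ Y.ρ h _)]
    simp only [Φ, LinearMap.sum_apply, LinearMap.comp_apply, LinearEquiv.coe_coe, hmid]
    simp [Finset.smul_sum, TensorProduct.smul_tmul'])
  evaluation_coevaluation' := by
    refine hom_ext (TensorProduct.ext' fun (c : k) (v : X) => ?_)
    change TensorProduct.map LinearMap.id (form f)
      (TensorProduct.assoc k X Y X ((c • (∑ i, x i ⊗ₜ[k] y i)) ⊗ₜ[k] v)) =
        (TensorProduct.rid k X).symm (TensorProduct.lid k X (c ⊗ₜ[k] v))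
    apply (TensorProduct.rid k X).injective
    simp [TensorProduct.sum_tmul, ← TensorProduct.smul_tmul', hx]
  coevaluation_evaluation' := by
    refine hom_ext (TensorProduct.ext' fun (v : Y) (c : k) => ?_)
    change TensorProduct.map (form f) LinearMap.id
      ((TensorProduct.assoc k Y X Y).symm (v ⊗ₜ[k] (c • (∑ i, x i ⊗ₜ[k] y i)))) =
        (TensorProduct.lid k Y).symm (TensorProduct.rid k Y (v ⊗ₜ[k] c))
    apply (TensorProduct.lid k Y).injective
    simp [TensorProduct.tmul_sum, hy]

/-- The morphism to the trivial representation given by an invariant bilinear form. -/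
noncomputable def homOfForm {X Y : FinRep k H} (f : X →ₗ[k] Y →ₗ[k] k)
    (hf : ∀ h x y, ∑ i ∈ (Repr.arbitrary k h).index,
      f (X.ρ ((Repr.arbitrary k h).left i) x) (Y.ρ ((Repr.arbitrary k h).right i) y) =
        counit (R := k) h * f x y) : X ⊗ Y ⟶ 𝟙_ (FinRep k H) where
  lin := TensorProduct.lift f
  comm h := LinearMap.congr_fun (f := TensorProduct.lift f ∘ₗ tensorAction X.ρ Y.ρ h)
    (g := counit (R := k) h • TensorProduct.lift f) (TensorProduct.ext' fun x y => by
      rw [tensorAction_eq_sum _ _ (Repr.arbitrary k h)]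
      simpa using hf h x y)

/-- The contragredient action, through the antipode. -/
noncomputable def dualAction (V : FinRep k H) : H →ₐ[k] Module.End k (Module.Dual k V) :=
  AlgHom.ofLinearMap (Module.Dual.transpose ∘ₗ V.ρ.toLinearMap ∘ₗ antipode k)
    (LinearMap.ext fun ξ => LinearMap.ext fun v => by
      simp [Module.Dual.transpose_apply])
    (fun a b => LinearMap.ext fun ξ => LinearMap.ext fun v => by
      simp [antipode_mul_antidistrib, Module.Dual.transpose_apply])

/-- The dual representation. -/
noncomputable def dual (V : FinRep k H) : FinRep k H where
  carrier := Module.Dual k V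
  ρ := dualAction V

/-- The evaluation form `V^* ⊗ V → k`. -/
noncomputable def dualEv (V : FinRep k H) : dual V ⊗ V ⟶ 𝟙_ (FinRep k H) :=
  homOfForm (X := dual V) (LinearMap.id : Module.Dual k V →ₗ[k] _) fun h (ξ : Module.Dual k V) v => by
    have hr := sum_antipode_mul_eq_smul (Repr.arbitrary k h)
    have hr2 := congrArg ξ (LinearMap.congr_fun (congrArg V.ρ hr) v)
    refine Eq.trans ?_ (hr2.trans ?_)
    · simp only [map_sum, LinearMap.sum_apply, map_mul]
      rfl
    · simp
      exact Or.inl rfl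

/-- The form `V ⊗ V^* → k`, `v ⊗ ξ ↦ ξ(u v)`, for an element `u` implementing the square of the
antipode. -/
noncomputable def dualEv' (V : FinRep k H) (u : H)
    (hu : ∀ h, u * h = antipode k (antipode k h) * u) : V ⊗ dual V ⟶ 𝟙_ (FinRep k H) :=
  homOfForm (Y := dual V) (Module.Dual.eval k V ∘ₗ V.ρ u) fun h v (ξ : Module.Dual k V) => by
    -- Invariance reads S(h₍₂₎) u h₍₁₎ = S(h₍₂₎) S²(h₍₁₎) u = S(S(h₍₁₎)h₍₂₎) u = ε(h)u.
    have hr := congrArg (fun x => antipode k x * u) (sum_antipode_mul_eq_smul (Repr.arbitrary k h))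
    have hr2 := congrArg ξ (LinearMap.congr_fun (congrArg V.ρ hr) v)
    simp only [map_sum, Finset.sum_mul, antipode_mul_antidistrib, mul_assoc, ← hu] at hr2
    refine Eq.trans ?_ (hr2.trans ?_)
    · simp only [map_sum, LinearMap.sum_apply, map_mul]
      rfl
    · simp
      exact Or.inl rfl

theorem nonempty_exactPairing_dual (V : FinRep k H) : Nonempty (ExactPairing V (dual V)) := by
  let b := Module.finBasis k V
  refine ⟨exactPairingOfForm (dualEv V) b (fun i => (b.coord i : Module.Dual k V)) (fun v => ?_)
    (fun (ξ : Module.Dual k V) => ?_)⟩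
  · exact b.sum_repr v
  · exact b.sum_dual_apply_smul_coord ξ

theorem nonempty_exactPairing_dual' (V : FinRep k H) {u : H}
    (hu : ∀ h, u * h = antipode k (antipode k h) * u) (hunit : IsUnit u) :
    Nonempty (ExactPairing (dual V) V) := by
  obtain ⟨⟨u, u', h1, h2⟩, rfl⟩ := hunit
  have h1' : ∀ v, V.ρ u (V.ρ u' v) = v := fun v => by
    rw [← Module.End.mul_apply, ← map_mul, h1, map_one, Module.End.one_apply]
  have h2' : ∀ v, V.ρ u' (V.ρ u v) = v := fun v => by
    rw [← Module.End.mul_apply, ← map_mul, h2, map_one, Module.End.one_apply]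
  let b := Module.finBasis k V
  refine ⟨exactPairingOfForm (dualEv' V u hu) (fun i => (b.coord i : Module.Dual k V))
    (fun i => V.ρ u' (b i)) (fun (ξ : Module.Dual k V) => ?_) (fun v => ?_)⟩
  · have : ∀ i, form (dualEv' V u hu) (V.ρ u' (b i) ⊗ₜ ξ) = ξ (b i) := fun i =>
      congrArg ξ (h1' (b i))
    simp only [this]
    exact b.sum_dual_apply_smul_coord ξ
  · have : ∀ i, form (dualEv' V u hu) (v ⊗ₜ (b.coord i : Module.Dual k V)) =
      b.repr (V.ρ u v) i := fun i => rfl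
    simp only [this, ← map_smul]
    rw [← map_sum, b.sum_repr, h2']

end FinRep

/-! ### Traces of cyclic permutations -/

namespace LinearMap

variable {k M W : Type*} [Field k] [AddCommGroup M] [Module k M] [Module.Finite k M]
  [AddCommGroup W] [Module k W] [Module.Finite k W]

theorem trace_map_comp_comm (a b : Module.End k M) :
    trace k (M ⊗[k] M) (TensorProduct.map a b ∘ₗ (TensorProduct.comm k M M).toLinearMap) =
      trace k M (a ∘ₗ b) := by
  obtain ⟨a, rfl⟩ := (dualTensorHomEquiv k M M).surjective a
  obtain ⟨b, rfl⟩ := (dualTensorHomEquiv k M M).surjective b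
  induction a using TensorProduct.induction_on with
  | zero => simp
  | add a a' ha ha' => simp only [map_add, TensorProduct.map_add_left, add_comp, ha, ha']
  | tmul f x =>
    induction b using TensorProduct.induction_on with
    | zero => simp
    | add b b' hb hb' =>
      simp only [map_add, TensorProduct.map_add_right, add_comp, comp_add, hb, hb']
    | tmul g y =>
      have h1 : TensorProduct.map (dualTensorHomEquiv k M M (f ⊗ₜ x))
          (dualTensorHomEquiv k M M (g ⊗ₜ y)) ∘ₗ (TensorProduct.comm k M M).toLinearMap =
          ((TensorProduct.lid k k).toLinearMap ∘ₗ TensorProduct.map g f).smulRight (x ⊗ₜ[k] y) := by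
        refine TensorProduct.ext' fun u v => ?_
        simp [TensorProduct.smul_tmul', smul_smul, mul_comm]
      have h2 : dualTensorHomEquiv k M M (f ⊗ₜ x) ∘ₗ dualTensorHomEquiv k M M (g ⊗ₜ y) =
          (f y • g).smulRight x := by
        ext u
        simp [smul_smul]
      rw [h1, h2, trace_smulRight, trace_smulRight]
      simp [mul_comm]

/-- Tracing against the swap of the two copies of M composes the operators on them. It is enough to
check this for D a pure tensor, where W splits off. -/
theorem trace_map_comp_leftComm (a : Module.End k M) (D : Module.End k (M ⊗[k] W)) :
    trace k (M ⊗[k] (M ⊗[k] W))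
      (TensorProduct.map a D ∘ₗ (TensorProduct.leftComm k M M W).toLinearMap) =
      trace k (M ⊗[k] W) (D ∘ₗ TensorProduct.map a LinearMap.id) := by
  obtain ⟨D, rfl⟩ := (homTensorHomEquiv k M W M W).surjective D
  induction D using TensorProduct.induction_on with
  | zero => simp
  | add D D' h h' => simp only [map_add, TensorProduct.map_add_right, add_comp, h, h']
  | tmul b c =>
    have h1 : (TensorProduct.assoc k M M W).symm.conj
        (TensorProduct.map a (homTensorHomEquiv k M W M W (b ⊗ₜ c)) ∘ₗ
          (TensorProduct.leftComm k M M W).toLinearMap) =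
        TensorProduct.map (TensorProduct.map a b ∘ₗ (TensorProduct.comm k M M).toLinearMap) c := by
      refine TensorProduct.ext_threefold fun u v w => ?_
      simp [LinearEquiv.conj_apply]
    have h2 : homTensorHomEquiv k M W M W (b ⊗ₜ c) ∘ₗ TensorProduct.map a LinearMap.id =
        TensorProduct.map (b ∘ₗ a) c := by
      refine TensorProduct.ext' fun u v => ?_
      simp
    rw [← trace_conj' _ (TensorProduct.assoc k M M W).symm, h1, h2, trace_tensorProduct',
      trace_tensorProduct', trace_map_comp_comm, trace_comp_comm']

end LinearMap

namespace HopfFS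

section CycStep

variable {k M W ι : Type*} [Field k] [AddCommGroup M] [Module k M] [AddCommGroup W] [Module k W]

/-- The operator `y ⊗ (v ⊗ t) ↦ v ⊗ C (y ⊗ t)`. -/
noncomputable def cycStep (C : M ⊗[k] W ≃ₗ[k] M ⊗[k] W) :
    M ⊗[k] (M ⊗[k] W) ≃ₗ[k] M ⊗[k] (M ⊗[k] W) :=
  TensorProduct.leftComm k M M W ≪≫ₗ TensorProduct.congr (LinearEquiv.refl k M) C

theorem cycStep_tmul (C : M ⊗[k] W ≃ₗ[k] M ⊗[k] W) (y v : M) (t : W) :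
    cycStep C (y ⊗ₜ (v ⊗ₜ t)) = v ⊗ₜ C (y ⊗ₜ t) := by
  simp [cycStep]

variable [Module.Finite k M] [Module.Finite k W]

/-- This is the inductive step for traces of cyclic permutations: one tensor factor is removed and
its operator is absorbed into Y, which is how tensor factors become a product in H. -/
theorem trace_cycStep (C : M ⊗[k] W ≃ₗ[k] M ⊗[k] W) (Y : Module.End k M) (s : Finset ι)
    (a : ι → Module.End k M) (τ : ι → Module.End k W) :
    LinearMap.trace k _ ((cycStep C).toLinearMap ∘ₗ
      TensorProduct.map Y (∑ i ∈ s, TensorProduct.map (a i) (τ i))) =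
      ∑ i ∈ s, LinearMap.trace k _ (C.toLinearMap ∘ₗ TensorProduct.map (Y ∘ₗ a i) (τ i)) := by
  have h : (cycStep C).toLinearMap ∘ₗ
      TensorProduct.map Y (∑ i ∈ s, TensorProduct.map (a i) (τ i)) =
      ∑ i ∈ s, TensorProduct.map (a i) (C.toLinearMap ∘ₗ TensorProduct.map Y (τ i)) ∘ₗ
        (TensorProduct.leftComm k M M W).toLinearMap := by
    refine TensorProduct.ext_threefold' fun y v t => ?_
    simp [cycStep, TensorProduct.tmul_sum]
  rw [h, map_sum]
  refine Finset.sum_congr rfl fun i _ => ?_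
  rw [LinearMap.trace_map_comp_leftComm, LinearMap.comp_assoc, ← TensorProduct.map_comp,
    LinearMap.comp_id]

theorem trace_cycStep_symm (C : M ⊗[k] W ≃ₗ[k] M ⊗[k] W) (Y : Module.End k M) (s : Finset ι)
    (a : ι → Module.End k M) (τ : ι → Module.End k W) :
    LinearMap.trace k _ ((cycStep C).symm.toLinearMap ∘ₗ
      TensorProduct.map Y (∑ i ∈ s, TensorProduct.map (a i) (τ i))) =
      ∑ i ∈ s, LinearMap.trace k _ (C.symm.toLinearMap ∘ₗ TensorProduct.map (a i ∘ₗ Y) (τ i)) := by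
  have h : (cycStep C).symm.toLinearMap ∘ₗ
      TensorProduct.map Y (∑ i ∈ s, TensorProduct.map (a i) (τ i)) =
      ∑ i ∈ s, (TensorProduct.leftComm k M M W).toLinearMap ∘ₗ
        TensorProduct.map Y (C.symm.toLinearMap ∘ₗ TensorProduct.map (a i) (τ i)) := by
    refine TensorProduct.ext_threefold' fun y v t => ?_
    simp only [cycStep, TensorProduct.tmul_sum, LinearMap.comp_apply, map_sum,
      TensorProduct.map_tmul, LinearMap.sum_apply]
    rfl
  rw [h, map_sum]
  refine Finset.sum_congr rfl fun i _ => ?_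
  rw [LinearMap.trace_comp_comm', LinearMap.trace_map_comp_leftComm, LinearMap.comp_assoc,
    ← TensorProduct.map_comp, LinearMap.comp_id]

end CycStep

variable {k H : Type u} [Field k] [Ring H]

open MonoidalCategory Coalgebra HopfAlgebra FinRep

section Bialgebra

variable [Bialgebra k H]

theorem convPow_zero_apply (f : H →ₗ[k] H) (h : H) :
    convPow k f 0 h = counit (R := k) h • 1 := by
  simp [convPow, Algebra.algebraMap_eq_smul_one]

theorem convPow_succ_apply {ι : Type*} (f : H →ₗ[k] H) (n : ℕ) {h : H} (r : Repr k h ι) :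
    convPow k f (n + 1) h = ∑ i ∈ r.index, f (r.left i) * convPow k f n (r.right i) := by
  simp [convPow, ← r.eq]

/-- The cyclic permutation `y ⊗ (v₁ ⊗ ⋯ ⊗ vₙ) ↦ v₁ ⊗ ⋯ ⊗ vₙ ⊗ y`, reassociated. -/
noncomputable def cyc (V : FinRep k H) : (n : ℕ) →
    (V ⊗[k] (tensorPow V n : FinRep k H)) ≃ₗ[k] (V ⊗[k] (tensorPow V n : FinRep k H))
  | 0 => LinearEquiv.refl k _
  | n + 1 => cycStep (cyc V n)

theorem cyc_tmul (V : FinRep k H) (n : ℕ) (v : V) (t : (tensorPow V n : FinRep k H)) :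
    cyc V n (v ⊗ₜ t) = (cycIso V n).hom.lin (t ⊗ₜ[k] v) := by
  induction n with
  | zero =>
    have h : ∀ c : k, v ⊗ₜ[k] c =
        (TensorProduct.rid k V).symm (TensorProduct.lid k V (c ⊗ₜ[k] v)) := fun c => by
      rw [TensorProduct.lid_tmul, TensorProduct.rid_symm_apply, TensorProduct.smul_tmul,
        smul_eq_mul, mul_one]
    exact h t
  | succ n ih =>
    let f : V ⊗[k] (tensorPow V n : FinRep k H) →ₗ[k]
      V ⊗[k] (V ⊗[k] (tensorPow V n : FinRep k H)) :=
        (cycStep (cyc V n)).toLinearMap ∘ₗ TensorProduct.mk k V _ v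
    let g : V ⊗[k] (tensorPow V n : FinRep k H) →ₗ[k]
      V ⊗[k] (V ⊗[k] (tensorPow V n : FinRep k H)) :=
        TensorProduct.map LinearMap.id (cycIso V n).hom.lin ∘ₗ
          (TensorProduct.assoc k V _ V).toLinearMap ∘ₗ (TensorProduct.mk k _ V).flip v
    have : f = g := TensorProduct.ext' fun w t' => by
      change cycStep (cyc V n) (v ⊗ₜ (w ⊗ₜ t')) = w ⊗ₜ[k] (cycIso V n).hom.lin (t' ⊗ₜ[k] v)
      rw [cycStep_tmul, ih]
      rfl
    exact LinearMap.congr_fun this t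

theorem tensorPow_zero_ρ (V : FinRep k H) (h : H) :
    (tensorPow V 0 : FinRep k H).ρ h = counit (R := k) h • LinearMap.id :=
  LinearMap.ext fun _ => rfl

theorem tensorPow_succ_ρ {ι : Type*} (V : FinRep k H) (n : ℕ) {h : H} (r : Repr k h ι) :
    (tensorPow V (n + 1) : FinRep k H).ρ h = ∑ i ∈ r.index,
      (TensorProduct.map (V.ρ (r.left i)) ((tensorPow V n : FinRep k H).ρ (r.right i)) :
        Module.End k (V ⊗[k] (tensorPow V n : FinRep k H))) :=
  tensorAction_eq_sum V.ρ (tensorPow V n : FinRep k H).ρ r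

theorem trace_map_smul_id_unit {M : Type*} [AddCommGroup M] [Module k M] [Module.Finite k M]
    (Y : Module.End k M) (c : k) :
    LinearMap.trace k (M ⊗[k] k) (TensorProduct.map Y (c • LinearMap.id)) =
      c * LinearMap.trace k M Y := by
  rw [LinearMap.trace_tensorProduct', map_smul, LinearMap.trace_id]
  simp [mul_comm]

/-- The trace of a cyclic permutation composed with the action on a tensor power. -/
theorem trace_cyc (V : FinRep k H) (n : ℕ) (Y : Module.End k V) (h : H) :
    LinearMap.trace k _ ((cyc V n).toLinearMap ∘ₗ
      TensorProduct.map Y ((tensorPow V n : FinRep k H).ρ h)) =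
      LinearMap.trace k V (Y ∘ₗ V.ρ (convPow k LinearMap.id n h)) := by
  induction n generalizing Y h with
  | zero =>
    rw [convPow_zero_apply, tensorPow_zero_ρ]
    refine (trace_map_smul_id_unit Y _).trans ?_
    rw [map_smul, map_one, LinearMap.comp_smul, map_smul]
    rfl
  | succ n ih =>
    refine (congrArg (fun z => LinearMap.trace k _ ((cyc V (n + 1)).toLinearMap ∘ₗ
      TensorProduct.map Y z)) (tensorPow_succ_ρ V n (Repr.arbitrary k h))).trans ?_
    refine (trace_cycStep (cyc V n) Y _ _ _).trans ?_
    rw [convPow_succ_apply _ n (Repr.arbitrary k h), map_sum, ← Module.End.mul_eq_comp, Finset.mul_sum,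
      map_sum]
    refine Finset.sum_congr rfl fun i _ => ?_
    rw [ih, map_mul V.ρ]
    rfl

end Bialgebra

/-- The trace of an inverse cyclic permutation composed with the action on a tensor power. -/
theorem trace_cyc_symm [HopfAlgebra k H] (V D : FinRep k H)
    (τ : Module.End k V →ₗ[k] Module.End k D) (hτ_one : τ 1 = 1)
    (hτ_mul : ∀ f g, τ (f * g) = τ g * τ f) (hτ : ∀ h, D.ρ h = τ (V.ρ (antipode k h)))
    (n : ℕ) (Y : Module.End k D) (h : H) :
    LinearMap.trace k _ ((cyc D n).symm.toLinearMap ∘ₗ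
      TensorProduct.map Y ((tensorPow D n : FinRep k H).ρ h)) =
      LinearMap.trace k D (Y ∘ₗ τ (V.ρ (convPow k (antipode k) n h))) := by
  induction n generalizing Y h with
  | zero =>
    rw [convPow_zero_apply, tensorPow_zero_ρ]
    refine (trace_map_smul_id_unit Y _).trans ?_
    rw [map_smul, map_one, map_smul, hτ_one, LinearMap.comp_smul, map_smul]
    rfl
  | succ n ih =>
    refine (congrArg (fun z => LinearMap.trace k _ ((cyc D (n + 1)).symm.toLinearMap ∘ₗ
      TensorProduct.map Y z)) (tensorPow_succ_ρ D n (Repr.arbitrary k h))).trans ?_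
    refine (trace_cycStep_symm (cyc D n) Y _ _ _).trans ?_
    rw [convPow_succ_apply _ n (Repr.arbitrary k h), map_sum, map_sum, ← Module.End.mul_eq_comp, Finset.mul_sum,
      map_sum]
    refine Finset.sum_congr rfl fun i _ => ?_
    rw [ih, map_mul V.ρ, hτ_mul, hτ, Module.End.mul_eq_comp, LinearMap.comp_assoc, LinearMap.trace_comp_comm',
      LinearMap.comp_assoc]
    rfl

/-- The trace of an operator composed with the action of an integral. -/
theorem trace_comp_integral [HopfAlgebra k H] {Λ : H} (hΛ : IsLeftIntegral k Λ) (W : FinRep k H)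
    (M : Module.End k W) (E : Module.End k (𝟙_ (FinRep k H) ⟶ W))
    (hE : ∀ f, M (vec f) = vec (E f)) :
    LinearMap.trace k W (M ∘ₗ W.ρ Λ) = counit (R := k) Λ * LinearMap.trace k _ E := by
  have hinv : ∀ (w : W) (h : H), W.ρ h (W.ρ Λ w) = counit (R := k) h • W.ρ Λ w := fun w h => by
    rw [← Module.End.mul_apply, ← map_mul, hΛ, map_smul]; rfl
  -- The integral maps into invariants: ρ(Λ) factors as `vec ∘ π`, while `π ∘ vec` is ε(Λ).
  -- Cyclicity of the trace then moves the computation to the invariants.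
  let π : W →ₗ[k] (𝟙_ (FinRep k H) ⟶ W) :=
    { toFun := fun w => homOfInvariant W (W.ρ Λ w) (hinv w)
      map_add' := fun w w' => vec_injective (by
        simp only [map_add, vec_homOfInvariant])
      map_smul' := fun c w => vec_injective (by
        simp only [map_smul, vec_homOfInvariant, RingHom.id_apply]) }
  have h1 : vec ∘ₗ π = W.ρ Λ := LinearMap.ext fun w =>
    vec_homOfInvariant W _ (hinv w)
  have h2 : π ∘ₗ vec = counit (R := k) Λ • LinearMap.id := LinearMap.ext fun f => vec_injective (by
    rw [LinearMap.comp_apply, ← LinearMap.comp_apply vec π, h1, ρ_vec, LinearMap.smul_apply,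
      map_smul, LinearMap.id_apply])
  have h3 : M ∘ₗ vec = vec ∘ₗ E := LinearMap.ext hE
  rw [← h1, ← LinearMap.comp_assoc, LinearMap.trace_comp_comm', h3, ← LinearMap.comp_assoc, h2,
    LinearMap.smul_comp, map_smul, LinearMap.id_comp, smul_eq_mul]

end HopfFS

/-! ### The pivotal map, rotations as twisted cyclic permutations, and transposes -/

namespace HopfFS

variable {k H : Type u} [Field k] [Ring H]

open MonoidalCategory Coalgebra HopfAlgebra FinRep

section Bialgebra

variable [Bialgebra k H] (V D : FinRep k H) [ExactPairing V D] [ExactPairing D V]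

/-- The linear map `V → V` induced by `V ≅ V^{**}`, for a two-sided dual `D` of `V`. -/
noncomputable def pivotal : Module.End k V where
  toFun v := TensorProduct.lid k V
    ((form (ε_ V D) ∘ₗ (TensorProduct.mk k D V).flip v).rTensor V (tvec (η_ D V)))
  map_add' v w := by
    rw [map_add, LinearMap.comp_add, LinearMap.rTensor_add, LinearMap.add_apply, map_add]
  map_smul' c v := by
    rw [map_smul, LinearMap.comp_smul, LinearMap.rTensor_smul, LinearMap.smul_apply, map_smul,
      RingHom.id_apply]

/-- The linear map `V → V` induced by `V^{**} ≅ V`, for a two-sided dual `D` of `V`. -/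
noncomputable def copivotal : Module.End k V where
  toFun v := TensorProduct.rid k V
    ((form (ε_ D V) ∘ₗ TensorProduct.mk k V D v).lTensor V (tvec (η_ V D)))
  map_add' v w := by
    rw [map_add, LinearMap.comp_add, LinearMap.lTensor_add, LinearMap.add_apply, map_add]
  map_smul' c v := by
    rw [map_smul, LinearMap.comp_smul, LinearMap.lTensor_smul, LinearMap.smul_apply, map_smul,
      RingHom.id_apply]

variable {V D}

theorem pivotal_apply {n : ℕ} {d : Fin n → D} {w : Fin n → V}
    (h : tvec (η_ D V) = ∑ i, d i ⊗ₜ[k] w i) (v : V) :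
    pivotal V D v = ∑ i, form (ε_ V D) (d i ⊗ₜ v) • w i := by
  change TensorProduct.lid k V
    ((form (ε_ V D) ∘ₗ (TensorProduct.mk k D V).flip v).rTensor V (tvec (η_ D V))) = _
  simp [h]

theorem copivotal_apply {n : ℕ} {x : Fin n → V} {e : Fin n → D}
    (h : tvec (η_ V D) = ∑ i, x i ⊗ₜ[k] e i) (v : V) :
    copivotal V D v = ∑ i, form (ε_ D V) (v ⊗ₜ e i) • x i := by
  change TensorProduct.rid k V
    ((form (ε_ D V) ∘ₗ TensorProduct.mk k V D v).lTensor V (tvec (η_ V D))) = _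
  simp [h]

theorem trace_sum_smulRight {M : Type*} [AddCommGroup M] [Module k M] [Module.Finite k M]
    {n : ℕ} (f : Module.End k M) (φ : Fin n → M →ₗ[k] k) (x : Fin n → M)
    (h : ∀ v, f v = ∑ i, φ i v • x i) : LinearMap.trace k M f = ∑ i, φ i (x i) := by
  have : f = ∑ i, (φ i).smulRight (x i) := LinearMap.ext fun v => by simp [h]
  rw [this, map_sum]
  simp

theorem trace_pivotal : LinearMap.trace k V (pivotal V D) = form (ε_ V D) (tvec (η_ D V)) := by
  obtain ⟨n, d, w, h, -, -⟩ := exists_sum_of_exactPairing D V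
  rw [trace_sum_smulRight _ (fun i => form (ε_ V D) ∘ₗ TensorProduct.mk k D V (d i)) w
    (pivotal_apply h), h, map_sum]
  rfl

theorem trace_copivotal :
    LinearMap.trace k V (copivotal V D) = form (ε_ D V) (tvec (η_ V D)) := by
  obtain ⟨n, x, e, h, -, -⟩ := exists_sum_of_exactPairing V D
  rw [trace_sum_smulRight _ (fun i => form (ε_ D V) ∘ₗ (TensorProduct.mk k V D).flip (e i)) x
    (copivotal_apply h), h, map_sum]
  rfl

/-- Expanding v by one zigzag identity for (D, V) and the vectors of D by one for (V, D) gives the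
same double sum on both sides. -/
theorem pivotal_mul_copivotal : pivotal V D * copivotal V D = 1 := by
  obtain ⟨n, x, e, h, -, hD⟩ := exists_sum_of_exactPairing V D
  obtain ⟨m, d, w, h', -, hV'⟩ := exists_sum_of_exactPairing D V
  refine LinearMap.ext fun v => ?_
  rw [Module.End.mul_apply, copivotal_apply h, map_sum, Module.End.one_apply]
  conv_rhs => rw [← hV' v]
  simp only [pivotal_apply h']
  rw [Finset.sum_comm]
  refine Finset.sum_congr rfl fun i _ => ?_
  conv_rhs => rw [← hD (d i)]
  simp only [TensorProduct.tmul_sum, TensorProduct.tmul_smul, map_sum, map_smul, Finset.sum_smul,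
    smul_eq_mul, mul_comm]

/-- The rotation is the cyclic permutation twisted by the pivotal map. -/
theorem vec_rotation (n : ℕ) (f : 𝟙_ (FinRep k H) ⟶ V ⊗ tensorPow V n) :
    tvec (rotation V D k n f) =
      cyc V n (TensorProduct.map (pivotal V D) LinearMap.id (tvec f)) := by
  obtain ⟨g, rfl⟩ := (coev_leftMate_bijective V D _).2 f
  obtain ⟨p, x, e, h, -, hD⟩ := exists_sum_of_exactPairing V D
  obtain ⟨m, d, w, h', -, hV'⟩ := exists_sum_of_exactPairing D V
  have h1 : tvec (η_ V D ≫ V ◁ g) = ∑ j, x j ⊗ₜ[k] g.lin (e j) := by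
    change TensorProduct.map LinearMap.id g.lin (tvec (η_ V D)) = _
    simp [h]
  have h2 : tvec (rotation V D k n (η_ V D ≫ V ◁ g)) =
      ∑ i, cyc V n (w i ⊗ₜ[k] g.lin (d i)) := by
    rw [rotation_apply]
    change (cycIso V n).hom.lin (TensorProduct.map g.lin LinearMap.id (tvec (η_ D V))) = _
    rw [h', map_sum]
    refine (map_sum (cycIso V n).hom.lin _ _).trans ?_
    refine Finset.sum_congr rfl fun i _ => ?_
    rw [cyc_tmul]
    rfl
  dsimp only
  rw [h1, h2, ← map_sum]
  congr 1
  -- Expanding each `d i` in the `e j` makes the coefficients of the pivotal map appear.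
  have h3 : ∀ i, w i ⊗ₜ[k] g.lin (d i) =
      ∑ j, form (ε_ V D) (d i ⊗ₜ x j) • w i ⊗ₜ[k] g.lin (e j) := fun i => by
    conv_lhs => rw [← hD (d i)]
    simp [TensorProduct.tmul_sum, TensorProduct.smul_tmul']
  simp only [h3, map_sum, TensorProduct.map_tmul, pivotal_apply h', TensorProduct.sum_tmul,
    TensorProduct.smul_tmul', LinearMap.id_apply]
  rw [Finset.sum_comm]

end Bialgebra

section Transpose

variable [Bialgebra k H] (V D : FinRep k H) [ExactPairing V D]

/-- The transpose of an operator with respect to a duality. -/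
noncomputable def transposeMap : Module.End k V →ₗ[k] Module.End k D :=
  LinearMap.flip
    { toFun := fun d =>
        { toFun := fun f => TensorProduct.lid k D
            ((form (ε_ V D) ∘ₗ TensorProduct.mk k D V d ∘ₗ f).rTensor D (tvec (η_ V D)))
          map_add' := fun f g => by
            rw [LinearMap.comp_add, LinearMap.comp_add, LinearMap.rTensor_add, LinearMap.add_apply,
              map_add]
          map_smul' := fun c f => by
            rw [LinearMap.comp_smul, LinearMap.comp_smul, LinearMap.rTensor_smul,
              LinearMap.smul_apply, map_smul, RingHom.id_apply] }
      map_add' := fun d d' => LinearMap.ext fun f => by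
        simp [LinearMap.add_comp, LinearMap.comp_add, LinearMap.rTensor_add]
      map_smul' := fun c d => LinearMap.ext fun f => by
        simp [LinearMap.smul_comp, LinearMap.comp_smul, LinearMap.rTensor_smul] }

variable {V D}

theorem transposeMap_apply {n : ℕ} {x : Fin n → V} {e : Fin n → D}
    (h : tvec (η_ V D) = ∑ i, x i ⊗ₜ[k] e i) (f : Module.End k V) (d : D) :
    transposeMap V D f d = ∑ i, form (ε_ V D) (d ⊗ₜ f (x i)) • e i := by
  change TensorProduct.lid k D
    ((form (ε_ V D) ∘ₗ TensorProduct.mk k D V d ∘ₗ f).rTensor D (tvec (η_ V D))) = _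
  simp [h]

theorem form_transposeMap (f : Module.End k V) (d : D) (v : V) :
    form (ε_ V D) (transposeMap V D f d ⊗ₜ v) = form (ε_ V D) (d ⊗ₜ f v) := by
  obtain ⟨n, x, e, h, hV, -⟩ := exists_sum_of_exactPairing V D
  rw [transposeMap_apply h]
  conv_rhs => rw [← hV v]
  simp [TensorProduct.sum_tmul, TensorProduct.tmul_sum, ← TensorProduct.smul_tmul', mul_comm]

theorem eq_of_form_eq {d d' : D}
    (h : ∀ v : V, form (ε_ V D) (d ⊗ₜ v) = form (ε_ V D) (d' ⊗ₜ v)) : d = d' := by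
  obtain ⟨n, x, e, -, -, hD⟩ := exists_sum_of_exactPairing V D
  rw [← hD d, ← hD d']
  simp only [h]

theorem transposeMap_one : transposeMap V D 1 = 1 :=
  LinearMap.ext fun d => eq_of_form_eq fun v => by
    rw [form_transposeMap, Module.End.one_apply, Module.End.one_apply]

theorem transposeMap_mul (f g : Module.End k V) :
    transposeMap V D (f * g) = transposeMap V D g * transposeMap V D f :=
  LinearMap.ext fun d => eq_of_form_eq fun v => by
    rw [form_transposeMap, Module.End.mul_apply, Module.End.mul_apply, form_transposeMap,
      form_transposeMap]

theorem trace_transposeMap (f : Module.End k V) :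
    LinearMap.trace k D (transposeMap V D f) = LinearMap.trace k V f := by
  obtain ⟨n, x, e, h, hV, hD⟩ := exists_sum_of_exactPairing V D
  rw [trace_sum_smulRight (transposeMap V D f)
    (fun i => form (ε_ V D) ∘ₗ (TensorProduct.mk k D V).flip (f (x i))) e (transposeMap_apply h f),
    trace_sum_smulRight f (fun i => form (ε_ V D) ∘ₗ TensorProduct.mk k D V (e i))
      (fun i => f (x i)) (fun v => by
        conv_lhs => rw [← hV v, map_sum]
        simp)]
  rfl

/-- Exchanging the roles of V and D inverts the transposed pivotal map. This expresses the inverse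
rotation for D through the pivotal map of V. -/
theorem pivotal_mul_transposeMap_pivotal [ExactPairing D V] :
    pivotal D V * transposeMap V D (pivotal V D) = 1 := by
  obtain ⟨n, x, e, h, -, hD⟩ := exists_sum_of_exactPairing V D
  obtain ⟨m, d, w, h', -, hV'⟩ := exists_sum_of_exactPairing D V
  refine LinearMap.ext fun ξ => ?_
  have h1 : transposeMap V D (pivotal V D) ξ = ∑ i, form (ε_ V D) (ξ ⊗ₜ w i) • d i := by
    rw [transposeMap_apply h]
    have h2 : ∀ i, form (ε_ V D) (ξ ⊗ₜ w i) • d i =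
        ∑ j, (form (ε_ V D) (d i ⊗ₜ x j) * form (ε_ V D) (ξ ⊗ₜ w i)) • e j := fun i => by
      conv_lhs => rw [← hD (d i)]
      simp only [Finset.smul_sum, smul_smul, mul_comm]
    simp only [h2, pivotal_apply h', TensorProduct.tmul_sum, TensorProduct.tmul_smul, map_sum,
      map_smul, Finset.sum_smul, smul_eq_mul]
    rw [Finset.sum_comm]
  rw [Module.End.mul_apply, h1, map_sum, Module.End.one_apply]
  conv_rhs => rw [← hD ξ]
  have h3 : ∀ j, form (ε_ V D) (ξ ⊗ₜ x j) =
      ∑ i, form (ε_ D V) (x j ⊗ₜ d i) * form (ε_ V D) (ξ ⊗ₜ w i) := fun j => by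
    conv_lhs => rw [← hV' (x j)]
    simp [TensorProduct.tmul_sum]
  simp only [pivotal_apply h, h3, Finset.sum_smul, TensorProduct.tmul_smul, map_smul, smul_eq_mul]
  rw [Finset.sum_comm]
  simp only [mul_comm]

end Transpose

section Hopf

variable [HopfAlgebra k H] {V D : FinRep k H} [ExactPairing V D]

theorem ρ_eq_transposeMap (h : H) : D.ρ h = transposeMap V D (V.ρ (antipode k h)) :=
  LinearMap.ext fun d => eq_of_form_eq fun v => by
    rw [form_ρ_tmul, form_transposeMap]

variable [ExactPairing D V]

/-- Acting by h on the V-leg of the invariant tensor in D ⊗ V equals acting by S(h) on its D-leg;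
the invariant form moves this to S²(h) on v. -/
theorem ρ_mul_pivotal (h : H) :
    V.ρ h * pivotal V D = pivotal V D * V.ρ (antipode k (antipode k h)) := by
  obtain ⟨m, d, w, h', -, -⟩ := exists_sum_of_exactPairing D V
  refine LinearMap.ext fun v => ?_
  have h1 := congrArg (fun z => TensorProduct.lid k V
    ((form (ε_ V D) ∘ₗ (TensorProduct.mk k D V).flip v).rTensor V z)) (map_ρ_tvec (η_ D V) h)
  rw [h'] at h1
  simp only [map_sum, TensorProduct.map_tmul, LinearMap.rTensor_tmul, LinearMap.comp_apply,
    LinearMap.flip_apply, TensorProduct.mk_apply, TensorProduct.lid_tmul, LinearMap.id_apply,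
    form_ρ_tmul] at h1
  rw [Module.End.mul_apply, Module.End.mul_apply, pivotal_apply h', pivotal_apply h', ← h1,
    map_sum]
  simp only [map_smul]

theorem counit_mul_trace_rotation {Λ : H} (hΛ : IsLeftIntegral k Λ) (n : ℕ) :
    counit (R := k) Λ * LinearMap.trace k _ (rotation V D k n).toLinearMap =
      LinearMap.trace k V (pivotal V D * V.ρ (convPow k LinearMap.id (n + 1) Λ)) := by
  have h1 := trace_comp_integral hΛ (V ⊗ tensorPow V n)
    ((cyc V n).toLinearMap ∘ₗ TensorProduct.map (pivotal V D) LinearMap.id)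
    (rotation V D k n).toLinearMap (fun f => (vec_rotation n f).symm)
  rw [← h1, convPow_succ_apply _ n (Repr.arbitrary k Λ), map_sum, Finset.mul_sum, map_sum]
  have h2 : ((cyc V n).toLinearMap ∘ₗ TensorProduct.map (pivotal V D) LinearMap.id) ∘ₗ
      (tensorAction V.ρ (tensorPow V n : FinRep k H).ρ Λ) =
      ∑ i ∈ (Repr.arbitrary k Λ).index, (cyc V n).toLinearMap ∘ₗ
        TensorProduct.map (pivotal V D * V.ρ ((Repr.arbitrary k Λ).left i))
          ((tensorPow V n : FinRep k H).ρ ((Repr.arbitrary k Λ).right i)) := by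
    rw [tensorAction_eq_sum _ _ (Repr.arbitrary k Λ)]
    refine TensorProduct.ext' fun v t => ?_
    simp
  refine (congrArg (LinearMap.trace k (V ⊗[k] (tensorPow V n : FinRep k H))) h2).trans ?_
  rw [map_sum]
  refine Finset.sum_congr rfl fun i _ => ?_
  rw [trace_cyc, map_mul V.ρ, ← mul_assoc]
  rfl

theorem counit_mul_trace_rotation_symm {Λ : H} (hΛ : IsLeftIntegral k Λ) (n : ℕ) :
    counit (R := k) Λ * LinearMap.trace k _ (rotation D V k n).symm.toLinearMap =
      LinearMap.trace k V (pivotal V D * V.ρ (convPow k (antipode k) (n + 1) Λ)) := by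
  have hinv : transposeMap V D (pivotal V D) * pivotal D V = 1 :=
    mul_eq_one_comm.1 pivotal_mul_transposeMap_pivotal
  let Z := transposeMap V D (pivotal V D)
  -- The rotation for D is its cyclic permutation after `pivotal D V`, whose inverse is `Z`; hence
  -- the order of factors here.
  have hM : ∀ f, (TensorProduct.map Z LinearMap.id ∘ₗ (cyc D n).symm.toLinearMap) (tvec f) =
      tvec ((rotation D V k n).symm f) := fun f => by
    obtain ⟨f, rfl⟩ := (rotation D V k n).surjective f
    rw [vec_rotation, LinearMap.comp_apply, LinearEquiv.coe_coe, LinearEquiv.symm_apply_apply,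
      LinearEquiv.symm_apply_apply, ← LinearMap.comp_apply, ← TensorProduct.map_comp,
      ← Module.End.mul_eq_comp, hinv]
    simp [Module.End.one_eq_id]
  have h1 := trace_comp_integral hΛ (D ⊗ tensorPow D n)
    (TensorProduct.map Z LinearMap.id ∘ₗ (cyc D n).symm.toLinearMap)
    (rotation D V k n).symm.toLinearMap hM
  rw [← h1, convPow_succ_apply _ n (Repr.arbitrary k Λ), map_sum, Finset.mul_sum, map_sum]
  have h2 : (cyc D n).symm.toLinearMap ∘ₗ
      (tensorAction D.ρ (tensorPow D n : FinRep k H).ρ Λ) ∘ₗ TensorProduct.map Z LinearMap.id =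
      ∑ i ∈ (Repr.arbitrary k Λ).index, (cyc D n).symm.toLinearMap ∘ₗ
        TensorProduct.map (D.ρ ((Repr.arbitrary k Λ).left i) * Z)
          ((tensorPow D n : FinRep k H).ρ ((Repr.arbitrary k Λ).right i)) := by
    rw [tensorAction_eq_sum _ _ (Repr.arbitrary k Λ)]
    refine TensorProduct.ext' fun v t => ?_
    simp
  have h3 : LinearMap.trace k (D ⊗[k] (tensorPow D n : FinRep k H))
      ((TensorProduct.map Z LinearMap.id ∘ₗ (cyc D n).symm.toLinearMap) ∘ₗ
        tensorAction D.ρ (tensorPow D n : FinRep k H).ρ Λ) =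
      LinearMap.trace k (D ⊗[k] (tensorPow D n : FinRep k H))
        ((cyc D n).symm.toLinearMap ∘ₗ (tensorAction D.ρ (tensorPow D n : FinRep k H).ρ Λ) ∘ₗ
          TensorProduct.map Z LinearMap.id) := by
    rw [LinearMap.comp_assoc, LinearMap.trace_comp_comm', LinearMap.comp_assoc]
  refine (h3.trans (congrArg _ h2)).trans ?_
  rw [map_sum]
  refine Finset.sum_congr rfl fun i _ => ?_
  -- All three operators on D are transposes from V, so the trace returns to V with the order of the
  -- product reversed.
  rw [trace_cyc_symm V D (transposeMap V D) transposeMap_one transposeMap_mul ρ_eq_transposeMap,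
    ← Module.End.mul_eq_comp, ρ_eq_transposeMap (V := V), ← transposeMap_mul, ← transposeMap_mul,
    trace_transposeMap, map_mul V.ρ]
  exact (LinearMap.trace_mul_comm k _ _).trans (congrArg _ (mul_assoc _ _ _))

end Hopf

end HopfFS

/-! ### Categorical formulas for the indicators of scalar-endomorphism representations -/

namespace HopfFS

variable {k H : Type u} [Field k] [Ring H] [HopfAlgebra k H]
  [IsSemisimpleRing H] {V D : FinRep k H}
  [ExactPairing V D] [ExactPairing D V]

open MonoidalCategory Coalgebra HopfAlgebra FinRep

theorem exists_pivotal_mul_ρ_uElem (hV : V.IsSchur) {Λ : H} (hΛ : IsLeftIntegral k Λ) :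
    ∃ a : k, pivotal V D * V.ρ (uElem k Λ) = a • 1 := by
  have hcomm : ∀ h, pivotal V D * V.ρ (uElem k Λ) * V.ρ h =
      V.ρ h * (pivotal V D * V.ρ (uElem k Λ)) := fun h => by
    rw [mul_assoc, ← map_mul, uElem_mul hΛ, map_mul, ← mul_assoc, ← mul_assoc, ρ_mul_pivotal]
  obtain ⟨a, ha⟩ := hV.2 ⟨pivotal V D * V.ρ (uElem k Λ), fun h v => LinearMap.congr_fun (hcomm h) v⟩
  exact ⟨a, congrArg Hom.lin ha⟩

/-- On a representation with scalar endomorphisms, `u⁻¹` acts as a multiple of the map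
`V → V` given by a two-sided dual. -/
theorem ρ_inverse_uElem (hV : V.IsSchur) (hd : (Module.finrank k V : k) ≠ 0) {Λ : H}
    (hΛ : IsLeftIntegral k Λ) (hc : counit (R := k) Λ ≠ 0) (hu : IsUnit (uElem k Λ)) :
    V.ρ (Ring.inverse (uElem k Λ)) =
      (form (ε_ D V) (tvec (η_ V D)) * (counit (R := k) Λ * Module.finrank k V)⁻¹) •
        pivotal V D := by
  obtain ⟨a, ha⟩ := exists_pivotal_mul_ρ_uElem (D := D) hV hΛ
  have hYX : copivotal V D * pivotal V D = 1 := mul_eq_one_comm.1 pivotal_mul_copivotal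
  have h1 : V.ρ (uElem k Λ) = a • copivotal V D := by
    rw [← one_mul (V.ρ _), ← hYX, mul_assoc, ha, mul_smul_comm, mul_one]
  have h2 : counit (R := k) Λ * Module.finrank k V = a * form (ε_ D V) (tvec (η_ V D)) := by
    rw [← character_uElem, character, h1, map_smul, trace_copivotal, smul_eq_mul]
  -- Nonvanishing of dim V in k makes both the scalar a and the loop tr(P⁻¹) invertible.
  have h3 : a * form (ε_ D V) (tvec (η_ V D)) ≠ 0 := h2 ▸ mul_ne_zero hc hd
  have h4 : pivotal V D = a • V.ρ (Ring.inverse (uElem k Λ)) := by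
    rw [← mul_one (pivotal V D), ← map_one V.ρ, ← Ring.mul_inverse_cancel _ hu, map_mul,
      ← mul_assoc, ha, smul_mul_assoc, one_mul]
  have h5 := left_ne_zero_of_mul h3
  have h6 := right_ne_zero_of_mul h3
  rw [h2, h4, smul_smul]
  conv_lhs => rw [← one_smul k (V.ρ _)]
  congr 1
  field_simp

theorem fsIndicator_eq_trace_pivotal
    (hV : V.IsSchur) (hd : (Module.finrank k V : k) ≠ 0) {Λ : H}
    (hΛ : IsLeftIntegral k Λ) (hc : counit (R := k) Λ ≠ 0) (hu : IsUnit (uElem k Λ)) (n : ℤ) :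
    fsIndicator k Λ n V =
      (form (ε_ D V) (tvec (η_ V D)) * (counit (R := k) Λ * Module.finrank k V)⁻¹) *
        LinearMap.trace k V (pivotal V D * V.ρ (sweedlerPow k n Λ)) := by
  rw [fsIndicator, character, map_mul, ρ_inverse_uElem (D := D) hV hd hΛ hc hu, smul_mul_assoc, map_smul,
    smul_eq_mul]

theorem fsIndicator_zero
    (hV : V.IsSchur) (hd : (Module.finrank k V : k) ≠ 0) {Λ : H}
    (hΛ : IsLeftIntegral k Λ) (hc : counit (R := k) Λ ≠ 0) (hu : IsUnit (uElem k Λ)) :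
    fsIndicator k Λ 0 V = form (ε_ D V) (tvec (η_ V D)) * (Module.finrank k V : k)⁻¹ *
      form (ε_ V D) (tvec (η_ D V)) := by
  rw [fsIndicator_eq_trace_pivotal (D := D) hV hd hΛ hc hu]
  change _ * LinearMap.trace k V (pivotal V D * V.ρ (convPow k LinearMap.id 0 Λ)) = _
  rw [convPow_zero_apply]
  simp only [map_smul, map_one, mul_smul_comm, mul_one, smul_eq_mul, trace_pivotal]
  field_simp

theorem fsIndicator_natCast_succ
    (hV : V.IsSchur) (hd : (Module.finrank k V : k) ≠ 0) {Λ : H}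
    (hΛ : IsLeftIntegral k Λ) (hc : counit (R := k) Λ ≠ 0) (hu : IsUnit (uElem k Λ)) (n : ℕ) :
    fsIndicator k Λ (Int.ofNat (n + 1)) V =
      form (ε_ D V) (tvec (η_ V D)) * (Module.finrank k V : k)⁻¹ *
        LinearMap.trace k _ (rotation V D k n).toLinearMap := by
  rw [fsIndicator_eq_trace_pivotal (D := D) hV hd hΛ hc hu]
  change _ * LinearMap.trace k V (pivotal V D * V.ρ (convPow k LinearMap.id (n + 1) Λ)) = _
  rw [← counit_mul_trace_rotation hΛ]
  field_simp

theorem fsIndicator_negSucc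
    (hV : V.IsSchur) (hd : (Module.finrank k V : k) ≠ 0) {Λ : H}
    (hΛ : IsLeftIntegral k Λ) (hc : counit (R := k) Λ ≠ 0) (hu : IsUnit (uElem k Λ)) (n : ℕ) :
    fsIndicator k Λ (Int.negSucc n) V =
      form (ε_ D V) (tvec (η_ V D)) * (Module.finrank k V : k)⁻¹ *
        LinearMap.trace k _ (rotation D V k n).symm.toLinearMap := by
  rw [fsIndicator_eq_trace_pivotal (D := D) hV hd hΛ hc hu]
  change _ * LinearMap.trace k V (pivotal V D * V.ρ (convPow k (antipode k) (n + 1) Λ)) = _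
  rw [← counit_mul_trace_rotation_symm hΛ]
  field_simp

end HopfFS

/-! ### Transport of the indicators along the equivalence -/

namespace HopfFS

open MonoidalCategory Coalgebra HopfAlgebra FinRep Functor.LaxMonoidal Functor.OplaxMonoidal

variable {k H H' : Type u} [Field k] [Ring H] [HopfAlgebra k H] [Ring H'] [HopfAlgebra k H']

/-- The scalar of an endomorphism of the trivial representation factored through `X ⊗ Y`. -/
theorem comp_eq_form_tvec_smul_id {X Y : FinRep k H} (f : 𝟙_ (FinRep k H) ⟶ X ⊗ Y)
    (g : X ⊗ Y ⟶ 𝟙_ (FinRep k H)) : f ≫ g = form g (tvec f) • 𝟙 (𝟙_ (FinRep k H)) :=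
  vec_injective (show _ = form g (tvec f) * (1 : k) from (mul_one _).symm)

section Functor

variable (F : FinRep k H ⥤ FinRep k H') [F.Monoidal]

/-- A two-sided dual of `F V` lifts to a two-sided dual of `V`. -/
theorem exists_exactPairing_map [F.IsEquivalence] (V : FinRep k H) (E : FinRep k H')
    [ExactPairing (F.obj V) E] [ExactPairing E (F.obj V)] :
    ∃ (D : FinRep k H) (_ : ExactPairing V D) (_ : ExactPairing D V)
      (_ : ExactPairing (F.obj V) (F.obj D)) (_ : ExactPairing (F.obj D) (F.obj V)),
      F.map (η_ V D) = η F ≫ η_ _ _ ≫ μ F _ _ ∧ F.map (η_ D V) = η F ≫ η_ _ _ ≫ μ F _ _ ∧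
      F.map (ε_ V D) = δ F _ _ ≫ ε_ _ _ ≫ ε F ∧ F.map (ε_ D V) = δ F _ _ ≫ ε_ _ _ ≫ ε F := by
  let D := F.objPreimage E
  let i : F.obj D ≅ E := F.objObjPreimageIso E
  let p1 : ExactPairing (F.obj V) (F.obj D) := exactPairingCongrRight i
  let p2 : ExactPairing (F.obj D) (F.obj V) := exactPairingCongrLeft i
  refine ⟨D, .ofFullyFaithful F V D, .ofFullyFaithful F D V, p1, p2, ?_, ?_, ?_, ?_⟩ <;>
    exact F.map_preimage _

variable [F.Linear k]

/-- The composite f ≫ g is a scalar multiple of the identity of the unit, and a linear monoidal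
functor preserves that scalar. -/
theorem form_tvec_map {X Y : FinRep k H} (f : 𝟙_ (FinRep k H) ⟶ X ⊗ Y)
    (g : X ⊗ Y ⟶ 𝟙_ (FinRep k H)) (f' : 𝟙_ (FinRep k H') ⟶ F.obj X ⊗ F.obj Y)
    (g' : F.obj X ⊗ F.obj Y ⟶ 𝟙_ (FinRep k H')) (hf : F.map f = η F ≫ f' ≫ μ F _ _)
    (hg : F.map g = δ F _ _ ≫ g' ≫ ε F) : form g' (tvec f') = form g (tvec f) := by
  have h1 : f' ≫ g' = ε F ≫ F.map (f ≫ g) ≫ η F := by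
    rw [F.map_comp, hf, hg]
    simp
  rw [comp_eq_form_tvec_smul_id, comp_eq_form_tvec_smul_id f g, F.map_smul, F.map_id,
    Linear.smul_comp, Category.id_comp, Linear.comp_smul, Functor.Monoidal.ε_η] at h1
  have h2 := congrArg vec h1
  rw [map_smul, map_smul] at h2
  exact (mul_one (_ : k)).symm.trans (h2.trans (mul_one (_ : k)))

variable [IsSemisimpleRing H] [IsSemisimpleRing H']

theorem fsIndicator_map_of_isSchur [F.Additive] [F.IsEquivalence] [Module.Finite k H] [Module.Finite k H']
    {V : FinRep k H} (hV : V.IsSchur) (hd : (Module.finrank k V : k) ≠ 0) {Λ : H} {Λ' : H'} (hΛ : IsLeftIntegral k Λ)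
    (hc : counit (R := k) Λ ≠ 0) (hu : IsUnit (uElem k Λ)) (hΛ' : IsLeftIntegral k Λ')
    (hc' : counit (R := k) Λ' ≠ 0) (hu' : IsUnit (uElem k Λ')) (n : ℤ) :
    fsIndicator k Λ n V = fsIndicator k Λ' n (F.obj V) := by
  obtain ⟨q1⟩ := nonempty_exactPairing_dual (F.obj V)
  -- A two-sided dual is built only over H', from the invertible u of H'; full faithfulness then
  -- lifts it to V with matching pairings.
  obtain ⟨q2⟩ := nonempty_exactPairing_dual' (F.obj V) (uElem_mul hΛ') hu'
  obtain ⟨D, _, _, _, _, h1, h2, h3, h4⟩ := exists_exactPairing_map F V (dual (F.obj V))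
  have hV' : (F.obj V).IsSchur := (isSchur_map_iff F V).2 hV
  have hd' : (Module.finrank k (F.obj V) : k) ≠ 0 := by rwa [finrank_map]
  have ha := form_tvec_map F _ _ _ _ h1 h4
  match n with
  | Int.ofNat 0 =>
    change fsIndicator k Λ 0 V = fsIndicator k Λ' 0 (F.obj V)
    rw [fsIndicator_zero (D := D) hV hd hΛ hc hu,
      fsIndicator_zero (D := F.obj D) hV' hd' hΛ' hc' hu', ha, form_tvec_map F _ _ _ _ h2 h3,
      finrank_map]
  | Int.ofNat (n + 1) =>
    rw [fsIndicator_natCast_succ (D := D) hV hd hΛ hc hu,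
      fsIndicator_natCast_succ (D := F.obj D) hV' hd' hΛ' hc' hu', ha,
      trace_rotation_map F k V D h1 h2, finrank_map]
  | Int.negSucc n =>
    rw [fsIndicator_negSucc (D := D) hV hd hΛ hc hu,
      fsIndicator_negSucc (D := F.obj D) hV' hd' hΛ' hc' hu', ha,
      trace_rotation_symm_map F k D V h2 h1, finrank_map]

end Functor

theorem fsIndicator_eq_add_of_decomposition {V W W' : FinRep k H} (i : W ⟶ V) (p : V ⟶ W)
    (i' : W' ⟶ V) (p' : V ⟶ W') (h : i ≫ p = 𝟙 W) (h' : i' ≫ p' = 𝟙 W')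
    (hs : p ≫ i + p' ≫ i' = 𝟙 V) (Λ : H) (n : ℤ) :
    fsIndicator k Λ n V = fsIndicator k Λ n W + fsIndicator k Λ n W' :=
  character_eq_of_decomposition i p i' p' h h' hs _

theorem fsIndicator_of_subsingleton (V : FinRep k H) [Subsingleton V] (Λ : H) (n : ℤ) :
    fsIndicator k Λ n V = 0 := by
  rw [fsIndicator, character, Subsingleton.elim (V.ρ _) 0, map_zero]

theorem fsIndicator_map [IsAlgClosed k] [Module.Finite k H] [Module.Finite k H']
    [IsSemisimpleRing H] [IsSemisimpleRing H']
    (F : FinRep k H ⥤ FinRep k H') [F.Additive] [F.Linear k] [F.Monoidal] [F.IsEquivalence]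
    (hdim : ∀ V : FinRep k H, V.IsSchur → (Module.finrank k V : k) ≠ 0) {Λ : H} {Λ' : H'}
    (hΛ : IsLeftIntegral k Λ)
    (hc : counit (R := k) Λ ≠ 0) (hu : IsUnit (uElem k Λ)) (hΛ' : IsLeftIntegral k Λ')
    (hc' : counit (R := k) Λ' ≠ 0) (hu' : IsUnit (uElem k Λ')) (n : ℤ) (V : FinRep k H) :
    fsIndicator k Λ n V = fsIndicator k Λ' n (F.obj V) := by
  induction hm : Module.finrank k V using Nat.strong_induction_on generalizing V with
  | _ m ih =>
  subst hm
  rcases subsingleton_or_nontrivial V with hV0 | hV0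
  · have : Subsingleton (F.obj V) := by
      rw [← Module.finrank_zero_iff (R := k), finrank_map]
      exact Module.finrank_zero_iff.2 hV0
    rw [fsIndicator_of_subsingleton, fsIndicator_of_subsingleton]
  by_cases hV : V.IsSchur
  · exact fsIndicator_map_of_isSchur F hV (hdim V hV) hΛ hc hu hΛ' hc' hu' n
  · obtain ⟨W, W', i, p, i', p', h, h', hs, hW, hW'⟩ := exists_decomposition V hV
    rw [fsIndicator_eq_add_of_decomposition i p i' p' h h' hs, ih _ hW W rfl, ih _ hW' W' rfl,
      fsIndicator_eq_add_of_decomposition (F.map i) (F.map p) (F.map i') (F.map p')]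
    · rw [← F.map_comp, h, F.map_id]
    · rw [← F.map_comp, h', F.map_id]
    · rw [← F.map_comp, ← F.map_comp, ← F.map_add, hs, F.map_id]

end HopfFS

/-! ### The characteristic bound and the conclusion -/

namespace FinRep

variable {k H : Type u} [Field k] [Ring H] [Algebra k H]

theorem IsSchur.natCast_finrank_ne_zero [IsSemisimpleRing H] [Module.Finite k H] {p : ℕ}
    [CharP k p] (hp : (Module.finrank k H : ℝ) ^ (1 / 2 : ℝ) < p) {V : FinRep k H}
    (hV : V.IsSchur) : (Module.finrank k V : k) ≠ 0 := by
  have := hV.1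
  have h1 : Module.finrank k H < p ^ 2 := by
    rw [← Real.sqrt_eq_rpow] at hp
    rw [Real.sqrt_lt' ((Real.sqrt_nonneg _).trans_lt hp)] at hp
    exact_mod_cast hp
  have h2 : Module.finrank k V < p := lt_of_pow_lt_pow_left₀ 2 p.zero_le (hV.finrank_sq_le.trans_lt h1)
  rw [Ne, CharP.cast_eq_zero_iff k p]
  exact Nat.not_dvd_of_pos_of_lt Module.finrank_pos h2

end FinRep

/-- Gauge invariance of the higher Frobenius-Schur indicators. -/
theorem mainTheorem1 (k : Type u) [Field k] [IsAlgClosed k] (p : ℕ) [CharP k p]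
    (H H' : Type u) [Ring H] [HopfAlgebra k H] [Ring H'] [HopfAlgebra k H']
    [Module.Finite k H] [Module.Finite k H'] [IsSemisimpleRing H] [IsSemisimpleRing H']
    (hp : (Module.finrank k H : ℝ) ^ (1 / 2 : ℝ) < p)
    (F : FinRep k H ⥤ FinRep k H') [F.Additive] [F.Linear k] [F.Monoidal] [F.IsEquivalence] :
    (∃ Λ : H, Λ ≠ 0 ∧ HopfFS.IsLeftIntegral k Λ) ∧
    (∃ Λ' : H', Λ' ≠ 0 ∧ HopfFS.IsLeftIntegral k Λ') ∧
    ∀ Λ : H, Λ ≠ 0 → HopfFS.IsLeftIntegral k Λ →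
    ∀ Λ' : H', Λ' ≠ 0 → HopfFS.IsLeftIntegral k Λ' →
      IsUnit (HopfFS.uElem k Λ) ∧ IsUnit (HopfFS.uElem k Λ') ∧
      ∀ (n : ℤ) (V : FinRep k H),
        HopfFS.fsIndicator k Λ n V = HopfFS.fsIndicator k Λ' n (F.obj V) := by
  have hdim : ∀ V : FinRep k H, V.IsSchur → (Module.finrank k V : k) ≠ 0 := fun _ hV =>
    hV.natCast_finrank_ne_zero hp
  -- The bound on p concerns H; it reaches H' because the equivalence preserves dimensions and
  -- endomorphisms.
  have hdim' : ∀ V : FinRep k H', V.IsSchur → (Module.finrank k V : k) ≠ 0 := fun V hV => by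
    have e := F.objObjPreimageIso V
    rw [← FinRep.finrank_eq_of_iso e, FinRep.finrank_map]
    exact hdim _ ((FinRep.isSchur_map_iff F _).1 (hV.of_iso e.symm))
  refine ⟨HopfFS.exists_leftIntegral k H, HopfFS.exists_leftIntegral k H',
    fun Λ h0 hΛ Λ' h0' hΛ' => ?_⟩
  have hu := HopfFS.isUnit_uElem hdim hΛ h0
  have hu' := HopfFS.isUnit_uElem hdim' hΛ' h0'
  exact ⟨hu, hu', HopfFS.fsIndicator_map F hdim hΛ (hΛ.counit_ne_zero h0) hu hΛ'
    (hΛ'.counit_ne_zero h0') hu'⟩
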